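/- Let $A$ be a unital $C^*$-algebra. For $S\subseteq A$ let $\mathrm{Id}_A(S)$ be the closed two-sided ideal of $A$ generated by $S$, and for a closed two-sided ideal $I$ let $[I,I]$ be the linear span of $\{xy-yx\mid x,y\in I\}$. A closed two-sided ideal $I\subseteq A$ is called perfect if $I=\mathrm{Id}_A([I,I])$. Let $U(A)$ be the unitary group of $A$ with the norm topology and let $U_A$ be its connected component of the unit. For a closed two-sided ideal $I$ let $U_I$ be the connected component of the unit of the group $\{u\in U(A)\mid u-1\in I\}$. Let $\mathrm{Aut}(A)$ be the group of $*$-automorphisms of $A$ with the topology of pointwise norm convergence. For $u\in U(A)$ put $\mathrm{Ad}(u)(a)=uau^*$, and let $$V_A=\overline{\{\mathrm{Ad}(u)\mid u\in U_A\}},\qquad V_I=\overline{\{\mathrm{Ad}(u)\mid u\in U_I\}},$$ with closures taken in $\mathrm{Aut}(A)$. A closed subgroup $H$ of $V_A$ is called topologically perfect if $H=\overline{(H,H)}$, where $(H,H)$ is the subgroup generated by the commutators $ghg^{-1}h^{-1}$ with $g,h\in H$. Then the map $I\mapsto V_I$ is a bijection from the set of perfect ideals of $A$ onto the set of topologically perfect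 closed normal subgroups of $V_A$. -/

import Mathlib

noncomputable section

namespace CStarNormal

variable {A : Type*} [CStarAlgebra A]

/-! ### The topological group of star-automorphisms -/

/-- The topology of pointwise norm convergence on the group of star-automorphisms of `A`. -/
instance autTopology : TopologicalSpace (A ≃⋆ₐ[ℂ] A) :=
  TopologicalSpace.induced (fun φ : A ≃⋆ₐ[ℂ] A => (φ : A → A)) inferInstance

theorem continuous_aut_iff {X : Type*} [TopologicalSpace X] {f : X → (A ≃⋆ₐ[ℂ] A)} :
    Continuous f ↔ ∀ a : A, Continuous fun x => f x a := by
  rw [continuous_induced_rng, continuous_pi_iff]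
  rfl

theorem continuous_aut_apply (a : A) : Continuous fun φ : A ≃⋆ₐ[ℂ] A => φ a :=
  continuous_aut_iff.1 continuous_id a

theorem aut_dist (φ : A ≃⋆ₐ[ℂ] A) (a b : A) : dist (φ a) (φ b) = dist a b :=
  (StarAlgEquiv.isometry φ).dist_eq a b

/-- Star-automorphisms are isometric, so composition and inversion are continuous. -/
instance autIsTopologicalGroup : IsTopologicalGroup (A ≃⋆ₐ[ℂ] A) where
  continuous_mul := by
    refine continuous_aut_iff.2 fun a => ?_
    rw [continuous_iff_continuousAt]
    rintro ⟨φ, ψ⟩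
    rw [ContinuousAt, tendsto_iff_dist_tendsto_zero]
    have h1 : Filter.Tendsto (fun p : (A ≃⋆ₐ[ℂ] A) × (A ≃⋆ₐ[ℂ] A) =>
        dist (p.2 a) (ψ a) + dist (p.1 (ψ a)) (φ (ψ a))) (nhds (φ, ψ)) (nhds 0) := by
      have : Continuous (fun p : (A ≃⋆ₐ[ℂ] A) × (A ≃⋆ₐ[ℂ] A) =>
          dist (p.2 a) (ψ a) + dist (p.1 (ψ a)) (φ (ψ a))) :=
        (((continuous_aut_apply a).comp continuous_snd).dist continuous_const).add
          (((continuous_aut_apply (ψ a)).comp continuous_fst).dist continuous_const)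
      simpa using this.tendsto (φ, ψ)
    refine squeeze_zero (fun _ => dist_nonneg) (fun p => ?_) h1
    calc dist (p.1 (p.2 a)) (φ (ψ a))
        ≤ dist (p.1 (p.2 a)) (p.1 (ψ a)) + dist (p.1 (ψ a)) (φ (ψ a)) := dist_triangle _ _ _
      _ = _ := by rw [aut_dist]
  continuous_inv := by
    refine continuous_aut_iff.2 fun a => ?_
    rw [continuous_iff_continuousAt]
    intro φ
    rw [ContinuousAt, tendsto_iff_dist_tendsto_zero]
    have h1 : Filter.Tendsto (fun ψ : A ≃⋆ₐ[ℂ] A => dist (φ (φ⁻¹ a)) (ψ (φ⁻¹ a)))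
        (nhds φ) (nhds 0) := by
      have : Continuous (fun ψ : A ≃⋆ₐ[ℂ] A => dist (φ (φ⁻¹ a)) (ψ (φ⁻¹ a))) :=
        continuous_const.dist (continuous_aut_apply (φ⁻¹ a))
      simpa using this.tendsto φ
    refine squeeze_zero (fun _ => dist_nonneg) (fun ψ => le_of_eq ?_) h1
    have e1 : φ (φ⁻¹ a) = a := φ.apply_symm_apply a
    have e2 : ψ (ψ⁻¹ a) = a := ψ.apply_symm_apply a
    rw [e1, ← aut_dist ψ (ψ⁻¹ a) (φ⁻¹ a), e2]

/-! ### Ideals -/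

/-- `[S, T]`: the linear span of the commutators `x * y - y * x` with `x ∈ S`, `y ∈ T`. -/
def commutatorSpan (S T : Set A) : Submodule ℂ A :=
  Submodule.span ℂ {z | ∃ x ∈ S, ∃ y ∈ T, z = x * y - y * x}

/-- `Id_A(S)`: the smallest closed two-sided ideal of `A` containing `S`. -/
def closedIdeal (S : Set A) : TwoSidedIdeal A :=
  sInf {J : TwoSidedIdeal A | IsClosed (J : Set A) ∧ S ⊆ (J : Set A)}

/-- A perfect ideal: a closed two-sided ideal `I` with `I = Id_A([I, I])`. -/
structure IsPerfectIdeal (I : TwoSidedIdeal A) : Prop where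
  isClosed : IsClosed (I : Set A)
  eq_closedIdeal : I = closedIdeal (commutatorSpan (I : Set A) (I : Set A) : Set A)

/-! ### Unitary groups and groups of approximately inner automorphisms -/

variable (A) in
/-- `U_A`: the connected component of `1` in the unitary group `U(A)` (norm topology). -/
def unitaryComponent : Subgroup (unitary A) :=
  Subgroup.connectedComponentOfOne (unitary A)

/-- `U(I) = {u ∈ U(A) | u - 1 ∈ I}`. -/
def idealUnitary (I : TwoSidedIdeal A) : Subgroup (unitary A) where
  carrier := {u | (u : A) - 1 ∈ I}
  one_mem' := by simp [I.zero_mem]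
  mul_mem' := by
    intro u v hu hv
    have h : ((u * v : unitary A) : A) - 1 = (u : A) * ((v : A) - 1) + ((u : A) - 1) := by
      simp [mul_sub]
    change ((u * v : unitary A) : A) - 1 ∈ I
    rw [h]
    exact I.add_mem (I.mul_mem_left _ _ hv) hu
  inv_mem' := by
    intro u hu
    have h : ((u⁻¹ : unitary A) : A) - 1 = -(((u⁻¹ : unitary A) : A) * ((u : A) - 1)) := by
      rw [mul_sub, ← Submonoid.coe_mul, inv_mul_cancel]
      simp
    change ((u⁻¹ : unitary A) : A) - 1 ∈ I
    rw [h]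
    exact I.neg_mem (I.mul_mem_left _ _ hu)

/-- `U_I`: the connected component of `1` in `U(I)`, as a subgroup of `U(A)`. -/
def idealUnitaryComponent (I : TwoSidedIdeal A) : Subgroup (unitary A) :=
  (Subgroup.connectedComponentOfOne (idealUnitary I)).map (idealUnitary I).subtype

/-- The closure in `Aut(A)` of `{Ad(u) | u ∈ G}`, where `Ad(u) a = u * a * star u`. -/
def adClosure (G : Subgroup (unitary A)) : Subgroup (A ≃⋆ₐ[ℂ] A) :=
  (G.map (Unitary.conjStarAlgAut ℂ A)).topologicalClosure

variable (A) in
/-- `V_A`: the closure in `Aut(A)` of `{Ad(u) | u ∈ U_A}`. -/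
def autV : Subgroup (A ≃⋆ₐ[ℂ] A) := adClosure (unitaryComponent A)

/-- `V_I`: the closure in `Aut(A)` of `{Ad(u) | u ∈ U_I}`. -/
def idealV (I : TwoSidedIdeal A) : Subgroup (A ≃⋆ₐ[ℂ] A) := adClosure (idealUnitaryComponent I)

/-- A closed subgroup `H` of a topological group is topologically perfect if its commutator
subgroup `(H, H)` is dense in it, that is, `H` is the closure of `(H, H)`. -/
def IsTopologicallyPerfect {G : Type*} [Group G] [TopologicalSpace G] [IsTopologicalGroup G]
    (H : Subgroup G) : Prop :=
  ⁅H, H⁆.topologicalClosure = H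

end CStarNormal

end

/-!
The correspondence between perfect ideals and topologically perfect closed normal subgroups rests on
a Lie theory for closed groups `H` of automorphisms. Write `e(x) = exp (i Re x)`. The Lie–Trotter
formula shows that the elements `z` with `Ad (e(c * z)) ∈ H` for all complex `c` form a closed
subspace `L(H)` of `A` (`lieSubmodule`); it contains `φ z - z` whenever `H` contains the commutators
of `φ` with the `Ad (e(c * z))`, and it is a Lie ideal when `H` is normal in `V_A`. For a closed
ideal `J` and closed `H`, the inclusion `V_J ≤ H` amounts to `J ⊆ L(H)`.

The main point (`mem_lieSubmodule_of_mem_ideal`) is that `J ⊆ L(H)` as soon as `L(H)` contains the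
commutators `star x * x - x * star x` with `x ∈ J`. Since `H` is closed for pointwise convergence,
it is enough to approximate the derivation induced by `h ∈ J` by derivations induced by combinations
of such commutators, uniformly on compact sets. By the Hahn–Banach theorem this says that a bounded
trace `g` on `J` vanishes if it is a combination of functionals `x ↦ f ([x, a])`
(`trace_of_commutators_eq_zero`). Let `m` be the supremum of `g` on the elements `0 ≤ c ≤ 1` of `J`.
In the bidual it is attained at a central projection; without leaving `J`, one considers the
elements `c` at which `g` almost attains `m`. They form a convex set that is invariant under unitary
conjugation and almost closed under `(c, d) ↦ c * d * c`. Those that nearly minimize a suitable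
positive functional therefore almost agree with their unitary conjugates, and convexity provides
some that almost commute in norm with any prescribed compact set. At these, `g` is almost `0`, so
`m ≤ 0`, and the same holds for `-g`.

It follows that `V_J` is topologically perfect for every closed ideal `J`, and that
`V_J = V_{J'}` with `J' = Id([J, J])`, which is a perfect ideal. If `I` is perfect then `V_I`
determines `I`, because the derivatives of `V_I` are the commutators with `I`. Finally, a
topologically perfect closed normal subgroup `H` equals `V_J` for `J = Id([L(H), L(H)])`
(`exists_idealV_eq`): Herstein's argument gives `[J, A] ⊆ L(H)`, so `V_J ≤ H`, while taking
commutators in `H` twice leads into `V_J`.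
-/

noncomputable section

namespace CStarNormal

open Filter Topology Complex

variable {A : Type*} [CStarAlgebra A]

local notation "Ad" => Unitary.conjStarAlgAut ℂ _

/-! ### Closed two-sided ideals -/

theorem smul_mem_ideal (K : TwoSidedIdeal A) {𝕜 : Type*} [CommSemiring 𝕜] [Algebra 𝕜 A] (c : 𝕜)
    {x : A} (hx : x ∈ K) : c • x ∈ K := by
  rw [Algebra.smul_def]
  exact K.mul_mem_left _ _ hx

/-- A closed ideal `K` contains every `x` with `star x * x ∈ K`: with `a = star x * x`, the element
`x` is the limit of `x * a * (a + ε)⁻¹ ∈ K` as `ε → 0`. -/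
theorem mem_of_star_mul_self_mem {K : TwoSidedIdeal A} (hK : IsClosed (K : Set A)) {x : A}
    (hx : star x * x ∈ K) : x ∈ K := by
  change x ∈ (K : Set A)
  rw [← hK.closure_eq, Metric.mem_closure_iff]
  intro δ hδ
  obtain ⟨ε, hε, hεδ⟩ : ∃ ε : ℝ, 0 < ε ∧ ε < δ ^ 2 := exists_between (by positivity)
  set a := star x * x with ha
  have hsa : IsSelfAdjoint a := IsSelfAdjoint.star_mul_self x
  have hspec : ∀ t ∈ spectrum ℝ a, 0 ≤ t := by
    let := CStarAlgebra.spectralOrder A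
    let := CStarAlgebra.spectralOrderedRing A
    exact fun t ht => spectrum_nonneg_of_nonneg (star_mul_self_nonneg x) ht
  have hc1 : ContinuousOn (fun t : ℝ => (t + ε)⁻¹) (spectrum ℝ a) :=
    ContinuousOn.inv₀ (by fun_prop) fun t ht => by have := hspec t ht; positivity
  have hc2 : ContinuousOn (fun t : ℝ => ε * (t + ε)⁻¹) (spectrum ℝ a) :=
    continuousOn_const.mul hc1
  set r := cfc (fun t : ℝ => ε * (t + ε)⁻¹) a with hr
  have h1 : 1 - r = a * cfc (fun t : ℝ => (t + ε)⁻¹) a := by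
    have e1 : a * cfc (fun t : ℝ => (t + ε)⁻¹) a = cfc (fun t : ℝ => t * (t + ε)⁻¹) a := by
      rw [cfc_mul (fun t : ℝ => t) (fun t : ℝ => (t + ε)⁻¹) a continuousOn_id hc1, cfc_id' ℝ a]
    rw [e1, hr, ← cfc_const_one ℝ a, ← cfc_sub _ _ a continuousOn_const hc2]
    refine cfc_congr fun t ht => ?_
    have := hspec t ht
    have : t + ε ≠ 0 := by positivity
    field_simp
    ring
  refine ⟨x - x * r, ?_, ?_⟩
  · have : x - x * r = x * (a * cfc (fun t : ℝ => (t + ε)⁻¹) a) := by rw [← h1]; noncomm_ring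
    rw [this]
    exact K.mul_mem_left _ _ (K.mul_mem_right _ _ hx)
  · rw [dist_eq_norm, sub_sub_cancel]
    have hrs : star r = r := (cfc_predicate (R := ℝ) (fun t : ℝ => ε * (t + ε)⁻¹) a)
    have h2 : star (x * r) * (x * r) =
        cfc (fun t : ℝ => ε * (t + ε)⁻¹ * t * (ε * (t + ε)⁻¹)) a := by
      rw [cfc_mul (fun t : ℝ => ε * (t + ε)⁻¹ * t) _ a (hc2.mul continuousOn_id) hc2,
        cfc_mul _ (fun t : ℝ => t) a hc2 continuousOn_id, cfc_id' ℝ a, star_mul, hrs, ← hr, ha]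
      simp only [mul_assoc]
    have h3 : ‖x * r‖ ^ 2 ≤ ε := by
      rw [sq, ← CStarRing.norm_star_mul_self, h2]
      refine norm_cfc_le hε.le fun t ht => ?_
      have ht0 := hspec t ht
      rw [Real.norm_of_nonneg (by positivity)]
      have : ε * (t + ε)⁻¹ * t * (ε * (t + ε)⁻¹) = ε * (ε * t / (t + ε) ^ 2) := by
        have : t + ε ≠ 0 := by positivity
        field_simp
      rw [this]
      refine mul_le_of_le_one_right hε.le ?_
      rw [div_le_one (by positivity)]
      nlinarith
    exact lt_of_pow_lt_pow_left₀ 2 hδ.le (h3.trans_lt hεδ)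

theorem star_mem_ideal {K : TwoSidedIdeal A} (hK : IsClosed (K : Set A)) {x : A} (hx : x ∈ K) :
    star x ∈ K := by
  refine mem_of_star_mul_self_mem hK ?_
  rw [star_star]
  exact K.mul_mem_right _ _ hx

theorem realPart_mem_ideal {K : TwoSidedIdeal A} (hK : IsClosed (K : Set A)) {x : A}
    (hx : x ∈ K) : (realPart x : A) ∈ K := by
  rw [realPart_apply_coe]
  exact smul_mem_ideal K _ (K.add_mem hx (star_mem_ideal hK hx))

/-- A closed ideal is stable under the non-unital continuous functional calculus. -/
theorem cfcₙ_mem_ideal {𝕜 : Type*} [RCLike 𝕜] [NormedAlgebra 𝕜 A] [StarModule 𝕜 A]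
    {p : A → Prop} [NonUnitalContinuousFunctionalCalculus 𝕜 A p]
    {K : TwoSidedIdeal A} (hK : IsClosed (K : Set A)) (f : 𝕜 → 𝕜) {a : A} (ha : a ∈ K) :
    cfcₙ f a ∈ K := by
  let S : NonUnitalStarSubalgebra 𝕜 A :=
    { carrier := K
      add_mem' := K.add_mem
      zero_mem' := K.zero_mem
      mul_mem' := fun h _ => K.mul_mem_right _ _ h
      smul_mem' := fun c _ h => smul_mem_ideal K c h
      star_mem' := star_mem_ideal hK }
  have : IsClosed (S : Set A) := hK
  exact cfcₙ_mem (s := S) f (show a ∈ S from ha)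

theorem exp_sub_one_mem_ideal {K : TwoSidedIdeal A} (hK : IsClosed (K : Set A)) {x : A}
    (hx : x ∈ K) : NormedSpace.exp x - 1 ∈ K := by
  have h := (NormedSpace.exp_series_hasSum_exp' (𝕂 := ℂ) x).tendsto_sum_nat
  have h' := ((tendsto_add_atTop_iff_nat 1).2 h).sub_const 1
  refine hK.mem_of_tendsto h' (Eventually.of_forall fun n => ?_)
  rw [Finset.sum_range_succ']
  simp only [Nat.factorial_zero, pow_zero, Nat.cast_one, inv_one, one_smul, add_sub_cancel_right]
  refine K.finsetSum_mem _ _ fun i _ => smul_mem_ideal K _ ?_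
  rw [pow_succ]
  exact K.mul_mem_left _ _ hx

/-- If a unitary `u` with `‖u - 1‖ < 2` is congruent to `1` modulo a closed ideal, then its
self-adjoint logarithm belongs to the ideal. -/
theorem argSelfAdjoint_mem_ideal {K : TwoSidedIdeal A} (hK : IsClosed (K : Set A)) {u : unitary A}
    (hu : (u : A) - 1 ∈ K) (hu2 : ‖(u - 1 : A)‖ < 2) : (Unitary.argSelfAdjoint u : A) ∈ K := by
  have hn : IsStarNormal ((u : A) - 1) := by
    rw [isStarNormal_iff]
    have : star (u : A) * u = u * star (u : A) := by simp
    simp only [commute_iff_eq, star_sub, star_one, mul_sub, sub_mul, this, one_mul, mul_one]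
    abel
  have e : (u : A) - 1 = cfc (fun z : ℂ => z - 1) (u : A) := by
    rw [cfc_sub .., cfc_id' ℂ (u : A), cfc_const_one ℂ (u : A)]
  have hcont : ContinuousOn (fun z : ℂ => (arg (z + 1) : ℂ)) (quasispectrum ℂ ((u : A) - 1)) := by
    refine continuous_ofReal.comp_continuousOn <|
      continuousOn_arg.comp (f := fun z : ℂ => z + 1) (by fun_prop) fun z hz => ?_
    rw [quasispectrum_eq_spectrum_union_zero, e, cfc_map_spectrum ..] at hz
    rcases hz with ⟨w, hw, rfl⟩ | rfl
    · simpa using (Unitary.spectrum_subset_slitPlane_iff_norm_lt_two u.2).mpr hu2 hw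
    · simp
  have key : (Unitary.argSelfAdjoint u : A) =
      cfcₙ (fun z : ℂ => (arg (z + 1) : ℂ)) ((u : A) - 1) := by
    rw [cfcₙ_eq_cfc (hf := hcont) (hf0 := by simp), Unitary.argSelfAdjoint_coe]
    conv_rhs => rw [e]
    rw [← cfc_comp' (fun z : ℂ => (arg (z + 1) : ℂ)) (fun z : ℂ => z - 1) (u : A)
      (hg := by
        rw [← cfc_map_spectrum .., ← e]
        exact hcont.mono (spectrum_subset_quasispectrum ℂ _))]
    simp
  rw [key]
  exact cfcₙ_mem_ideal hK _ hu

theorem subset_closedIdeal (S : Set A) : S ⊆ (closedIdeal S : Set A) := fun x hx => by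
  rw [SetLike.mem_coe, closedIdeal, TwoSidedIdeal.mem_sInf]
  exact fun J hJ => hJ.2 hx

theorem isClosed_closedIdeal (S : Set A) : IsClosed (closedIdeal S : Set A) := by
  have : (closedIdeal S : Set A) =
      ⋂ J ∈ {J : TwoSidedIdeal A | IsClosed (J : Set A) ∧ S ⊆ (J : Set A)}, (J : Set A) := by
    ext x
    simp only [closedIdeal, SetLike.mem_coe, TwoSidedIdeal.mem_sInf, Set.mem_iInter]
  rw [this]
  exact isClosed_biInter fun J hJ => hJ.1

theorem closedIdeal_le {S : Set A} {J : TwoSidedIdeal A} (hJ : IsClosed (J : Set A))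
    (h : S ⊆ (J : Set A)) : closedIdeal S ≤ J :=
  sInf_le ⟨hJ, h⟩

theorem commutator_mem_closedIdeal {J : TwoSidedIdeal A} {x y : A} (hx : x ∈ J) (hy : y ∈ J) :
    x * y - y * x ∈ closedIdeal (commutatorSpan (J : Set A) (J : Set A) : Set A) :=
  subset_closedIdeal _ (Submodule.subset_span ⟨x, hx, y, hy, rfl⟩)

theorem closedIdeal_commutatorSpan_le {J K : TwoSidedIdeal A} (hK : IsClosed (K : Set A))
    (h : ∀ x ∈ J, ∀ y ∈ J, x * y - y * x ∈ K) :
    closedIdeal (commutatorSpan (J : Set A) (J : Set A) : Set A) ≤ K := by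
  refine closedIdeal_le hK fun z hz => ?_
  induction hz using Submodule.span_induction with
  | mem z hz => obtain ⟨x, hx, y, hy, rfl⟩ := hz; exact h x hx y hy
  | zero => exact K.zero_mem
  | add z w _ _ hz hw => exact K.add_mem hz hw
  | smul c z _ hz => exact smul_mem_ideal K c hz

theorem closedIdeal_commutatorSpan_le_self {J : TwoSidedIdeal A} (hJ : IsClosed (J : Set A)) :
    closedIdeal (commutatorSpan (J : Set A) (J : Set A) : Set A) ≤ J :=
  closedIdeal_commutatorSpan_le hJ fun _ hx _ hy =>
    J.sub_mem (J.mul_mem_left _ _ hy) (J.mul_mem_left _ _ hx)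

/-- For a closed ideal `J`, the closed ideal `J'` generated by `[J, J]` is perfect. Modulo the
closed ideal `K` generated by `[J', J']`, the ideal `J'` is commutative, hence central; so for
`x y ∈ J` the commutator `z = [x, y]` is central modulo `K` and
`z ^ 2 = [x * z, y] = [[x, x * y], y]` vanishes modulo `K`, which forces `z ∈ K`. -/
theorem isPerfectIdeal_closedIdeal_commutatorSpan (J : TwoSidedIdeal A) :
    IsPerfectIdeal (closedIdeal (commutatorSpan (J : Set A) (J : Set A) : Set A)) := by
  set J' := closedIdeal (commutatorSpan (J : Set A) (J : Set A) : Set A) with hJ'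
  have hJ'c : IsClosed (J' : Set A) := isClosed_closedIdeal _
  set K := closedIdeal (commutatorSpan (J' : Set A) (J' : Set A) : Set A) with hK
  have hKc : IsClosed (K : Set A) := isClosed_closedIdeal _
  have hcomm : ∀ p ∈ J', ∀ q ∈ J', p * q - q * p ∈ K := fun p hp q hq =>
    commutator_mem_closedIdeal hp hq
  have hcentral : ∀ p ∈ J', ∀ a : A, p * a - a * p ∈ K := by
    intro p hp a
    have h0 : p * a - a * p ∈ J' := J'.sub_mem (J'.mul_mem_right _ _ hp) (J'.mul_mem_left _ _ hp)
    have h1 : ∀ q ∈ J', (p * a - a * p) * q ∈ K := by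
      intro q hq
      have : (p * a - a * p) * q = (p * (a * q) - (a * q) * p) - a * (p * q - q * p) := by
        noncomm_ring
      rw [this]
      exact K.sub_mem (hcomm _ hp _ (J'.mul_mem_left _ _ hq))
        (K.mul_mem_left _ _ (hcomm _ hp _ hq))
    have h2 := h1 _ (star_mem_ideal hJ'c h0)
    rw [← star_star (p * a - a * p)]
    refine star_mem_ideal hKc (mem_of_star_mul_self_mem hKc ?_)
    rwa [star_star]
  refine ⟨hJ'c, le_antisymm ?_ (closedIdeal_commutatorSpan_le_self hJ'c)⟩
  refine closedIdeal_commutatorSpan_le hKc fun x hx y hy => ?_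
  have hxy : x * y - y * x ∈ J' := commutator_mem_closedIdeal hx hy
  have hxxy : x * (x * y) - x * y * x ∈ J' :=
    commutator_mem_closedIdeal hx (J.mul_mem_left _ _ hy)
  set z := x * y - y * x with hz
  have hzz : z * z ∈ K := by
    have h1 := hcentral _ hxxy y
    have h2 := K.mul_mem_left x _ (hcentral _ hxy y)
    have : z * z = ((x * (x * y) - x * y * x) * y - y * (x * (x * y) - x * y * x))
        - x * (z * y - y * z) := by
      rw [hz]; noncomm_ring
    rw [this]
    exact K.sub_mem h1 h2
  have h3 : star (star z * z) * (star z * z) ∈ K := by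
    have : star (star z * z) * (star z * z)
        = star z * (z * star z - star z * z) * z + star z * star z * (z * z) := by
      simp only [star_mul, star_star]; noncomm_ring
    rw [this]
    exact K.add_mem (K.mul_mem_right _ _ (K.mul_mem_left _ _ (hcentral _ hxy _)))
      (K.mul_mem_left _ _ hzz)
  exact mem_of_star_mul_self_mem hKc (mem_of_star_mul_self_mem hKc h3)

/-! ### Traces on a closed ideal and their almost central maximizers -/

section Order

variable [PartialOrder A]

/-- The elements `0 ≤ c ≤ 1` of the ideal `J` at which the functional `g` is within `δ` of `m`. It
is used with `m` the supremum of `g` on the positive part of the unit ball of `J`. -/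
def almostMaximizers (J : TwoSidedIdeal A) (g : A →ₗ[ℝ] ℝ) (m δ : ℝ) : Set A :=
  {c | c ∈ J ∧ 0 ≤ c ∧ c ≤ 1 ∧ m - δ ≤ g c}

theorem almostMaximizers_mono {J : TwoSidedIdeal A} {g : A →ₗ[ℝ] ℝ} {m δ δ' : ℝ} (h : δ ≤ δ') :
    almostMaximizers J g m δ ⊆ almostMaximizers J g m δ' :=
  fun _ hc => ⟨hc.1, hc.2.1, hc.2.2.1, by linarith [hc.2.2.2]⟩

variable [StarOrderedRing A]

/-- Every bounded real functional is controlled on self-adjoint elements by a positive one. This is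
the Jordan decomposition `f = φ₁ - φ₂` with `φ = φ₁ + φ₂`, obtained by extending
`(x + s, -x + s) ↦ f x + C * s` to a positive functional on pairs, followed by completing the
square. -/
theorem exists_positive_dominating (f : A →L[ℝ] ℝ) :
    ∃ φ : A →ₗ[ℝ] ℝ, (∀ y, 0 ≤ y → 0 ≤ φ y) ∧
      ∀ y, IsSelfAdjoint y → ∀ r : ℝ, 0 < r → 2 * f y ≤ r * φ 1 + r⁻¹ * φ (y * y) := by
  rcases subsingleton_or_nontrivial A with hA | hA
  · refine ⟨0, fun _ _ => le_rfl, fun y _ r _ => ?_⟩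
    rw [Subsingleton.elim y 0]
    simp
  let one : selfAdjoint A := 1
  let ι : selfAdjoint A × ℝ →ₗ[ℝ] selfAdjoint A × selfAdjoint A :=
    { toFun := fun p => (p.1 + p.2 • one, -p.1 + p.2 • one)
      map_add' := fun p q => by ext <;> simp [add_smul] <;> abel
      map_smul' := fun c p => by ext <;> simp [smul_smul] }
  have hι : Function.Injective ι := by
    rw [← LinearMap.ker_eq_bot, LinearMap.ker_eq_bot']
    rintro ⟨x, s⟩ h
    have h1 : x + s • one = 0 := congr_arg Prod.fst h
    have h2 : -x + s • one = 0 := congr_arg Prod.snd h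
    have h3 : (2 * s) • (1 : A) = 0 := by
      have := congr_arg (Subtype.val) (congr_arg₂ (· + ·) h1 h2)
      simp only [one, AddSubgroup.coe_add, selfAdjoint.val_smul, selfAdjoint.val_one,
        AddSubgroup.coe_neg, AddSubgroup.coe_zero, add_zero] at this
      rw [mul_smul, two_smul, ← this]
      abel
    have h4 : s = 0 := by
      rcases smul_eq_zero.1 h3 with h | h
      · linarith
      · exact absurd h one_ne_zero
    subst h4
    simpa using h1
  let C : ℝ := 2 * ‖f‖ + |f 1|
  let f₀ : selfAdjoint A × ℝ →ₗ[ℝ] ℝ :=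
    { toFun := fun p => f p.1 + C * p.2
      map_add' := fun p q => by simp; ring
      map_smul' := fun c p => by simp; ring }
  let f₁ : (selfAdjoint A × selfAdjoint A) →ₗ.[ℝ] ℝ :=
    ⟨LinearMap.range ι, f₀ ∘ₗ (LinearEquiv.ofInjective ι hι).symm.toLinearMap⟩
  have hf₁ : ∀ p (hp : ι p ∈ f₁.domain), f₁ ⟨ι p, hp⟩ = f₀ p := by
    intro p hp
    change f₀ ((LinearEquiv.ofInjective ι hι).symm ⟨ι p, hp⟩) = f₀ p
    congr 1
    rw [LinearEquiv.symm_apply_eq]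
    rfl
  let S : PointedCone ℝ (selfAdjoint A × selfAdjoint A) :=
    { carrier := {p | 0 ≤ (p.1 : A) ∧ 0 ≤ (p.2 : A)}
      add_mem' := fun {p q} hp hq => ⟨add_nonneg hp.1 hq.1, add_nonneg hp.2 hq.2⟩
      zero_mem' := ⟨le_rfl, le_rfl⟩
      smul_mem' := fun c p hp => ⟨smul_nonneg c.2 hp.1, smul_nonneg c.2 hp.2⟩ }
  obtain ⟨g, hg1, hg2⟩ := riesz_extension S f₁ (by
    rintro ⟨_, ⟨x, s⟩, rfl⟩ hx
    refine le_of_le_of_eq ?_ (hf₁ (x, s) _).symm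
    change 0 ≤ f x + C * s
    have h1 : 0 ≤ (x : A) + s • (1 : A) := hx.1
    have h2 : 0 ≤ -(x : A) + s • (1 : A) := hx.2
    have h3 : (x : A) + s • (1 : A) ≤ algebraMap ℝ A (2 * s) := by
      rw [Algebra.algebraMap_eq_smul_one, mul_smul, two_smul, ← sub_nonneg]
      convert h2 using 1
      abel
    have hs : 0 ≤ s := by
      by_contra! hs
      have h5 : (algebraMap ℝ A (2 * s)) ≤ 0 := by
        rw [Algebra.algebraMap_eq_smul_one, ← neg_nonneg, ← neg_smul]
        exact smul_nonneg (by linarith) zero_le_one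
      have h6 := le_antisymm h5 (h1.trans h3)
      rw [map_eq_zero] at h6
      linarith
    have h4 := (CStarAlgebra.norm_le_iff_le_algebraMap _ (by linarith) h1).2 h3
    have h5 : f (x : A) = f ((x : A) + s • (1 : A)) - s * f 1 := by simp
    have h6 := (abs_le.1 ((f.le_opNorm _).trans (mul_le_mul_of_nonneg_left h4 (norm_nonneg f)))).1
    have h7 : s * f 1 ≤ s * |f 1| := mul_le_mul_of_nonneg_left (le_abs_self _) hs
    simp only [C]
    rw [h5]
    linarith) (by
    intro p
    refine ⟨⟨ι (0, ‖(p.1 : A)‖ + ‖(p.2 : A)‖), LinearMap.mem_range_self _ _⟩, ?_, ?_⟩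
    · have h := IsSelfAdjoint.neg_algebraMap_norm_le_self (a := (p.1 : A)) p.1.2
      have h' : 0 ≤ ‖(p.2 : A)‖ • (1 : A) := smul_nonneg (norm_nonneg _) zero_le_one
      rw [Algebra.algebraMap_eq_smul_one, neg_le_iff_add_nonneg] at h
      change 0 ≤
        (((0 : selfAdjoint A) + (‖(p.1 : A)‖ + ‖(p.2 : A)‖) • one + p.1 : selfAdjoint A) : A)
      simp only [one, AddSubgroup.coe_add, selfAdjoint.val_smul, selfAdjoint.val_one, zero_add,
        add_smul]
      convert add_nonneg h h' using 1
      abel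
    · have h := IsSelfAdjoint.neg_algebraMap_norm_le_self (a := (p.2 : A)) p.2.2
      have h' : 0 ≤ ‖(p.1 : A)‖ • (1 : A) := smul_nonneg (norm_nonneg _) zero_le_one
      rw [Algebra.algebraMap_eq_smul_one, neg_le_iff_add_nonneg] at h
      change 0 ≤
        ((-(0 : selfAdjoint A) + (‖(p.1 : A)‖ + ‖(p.2 : A)‖) • one + p.2 : selfAdjoint A) : A)
      simp only [one, AddSubgroup.coe_add, selfAdjoint.val_smul, selfAdjoint.val_one, zero_add,
        add_smul, neg_zero]
      convert add_nonneg h h' using 1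
      abel)
  let φ₁ : A →ₗ[ℝ] ℝ := g ∘ₗ LinearMap.inl ℝ _ _ ∘ₗ realPart
  let φ₂ : A →ₗ[ℝ] ℝ := g ∘ₗ LinearMap.inr ℝ _ _ ∘ₗ realPart
  have hre : ∀ y : A, IsSelfAdjoint y → ((realPart y : selfAdjoint A) : A) = y :=
    fun y hy => hy.coe_realPart
  have hφ₁ : ∀ y, 0 ≤ y → 0 ≤ φ₁ y := fun y hy =>
    hg2 _ ⟨by simpa [hre y (.of_nonneg hy)] using hy, le_rfl⟩
  have hφ₂ : ∀ y, 0 ≤ y → 0 ≤ φ₂ y := fun y hy =>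
    hg2 _ ⟨le_rfl, by simpa [hre y (.of_nonneg hy)] using hy⟩
  have hf : ∀ y, IsSelfAdjoint y → f y = φ₁ y - φ₂ y := by
    intro y hy
    have h1 := hg1 ⟨ι (realPart y, 0), LinearMap.mem_range_self _ _⟩
    rw [hf₁] at h1
    have h2 : f₀ (realPart y, 0) = f y := by
      change f (realPart y : A) + C * 0 = f y
      rw [hre y hy, mul_zero, add_zero]
    rw [← h2, ← h1]
    change _ = g (realPart y, 0) - g (0, realPart y)
    rw [← map_sub]
    congr 1
    ext <;> simp [ι]
  have hsq : ∀ φ : A →ₗ[ℝ] ℝ, (∀ y, 0 ≤ y → 0 ≤ φ y) → ∀ y, IsSelfAdjoint y → ∀ r : ℝ, 0 < r →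
      2 * φ y ≤ r * φ 1 + r⁻¹ * φ (y * y) := by
    intro φ hφ y hy r hr
    have h1 : 0 ≤ φ ((y - r • 1) * (y - r • 1)) := by
      have : star (y - r • (1 : A)) = y - r • 1 := by simp [hy.star_eq]
      refine hφ _ ?_
      have h := star_mul_self_nonneg (y - r • (1 : A))
      rwa [this] at h
    have h2 : (y - r • 1) * (y - r • 1) = y * y - (2 * r) • y + (r * r) • (1 : A) := by
      simp only [sub_mul, mul_sub, smul_mul_assoc, mul_smul_comm, one_mul, mul_one]
      module
    rw [h2, map_add, map_sub, map_smul, map_smul, smul_eq_mul, smul_eq_mul] at h1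
    have h3 : 0 ≤ r⁻¹ * (φ (y * y) - 2 * r * φ y + r * r * φ 1) := by positivity
    have h4 : r⁻¹ * (φ (y * y) - 2 * r * φ y + r * r * φ 1)
        = r⁻¹ * φ (y * y) - 2 * φ y + r * φ 1 := by field_simp
    linarith
  refine ⟨φ₁ + φ₂, fun y hy => add_nonneg (hφ₁ y hy) (hφ₂ y hy), fun y hy r hr => ?_⟩
  have h1 := hsq φ₁ hφ₁ y hy r hr
  have h2 := hsq φ₂ hφ₂ (-y) hy.neg r hr
  rw [hf y hy]
  simp only [map_neg, neg_mul_neg, LinearMap.add_apply] at h2 ⊢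
  linarith

theorem convex_almostMaximizers (J : TwoSidedIdeal A) (g : A →ₗ[ℝ] ℝ) (m δ : ℝ) :
    Convex ℝ (almostMaximizers J g m δ) := by
  intro c hc d hd a b ha hb hab
  refine ⟨J.add_mem (smul_mem_ideal J a hc.1) (smul_mem_ideal J b hd.1),
    add_nonneg (smul_nonneg ha hc.2.1) (smul_nonneg hb hd.2.1), ?_, ?_⟩
  · calc a • c + b • d ≤ a • (1 : A) + b • (1 : A) :=
        add_le_add (smul_le_smul_of_nonneg_left hc.2.2.1 ha)
          (smul_le_smul_of_nonneg_left hd.2.2.1 hb)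
      _ = 1 := by rw [← add_smul, hab, one_smul]
  · rw [map_add, map_smul, map_smul, smul_eq_mul, smul_eq_mul]
    have h1 := mul_le_mul_of_nonneg_left hc.2.2.2 ha
    have h2 := mul_le_mul_of_nonneg_left hd.2.2.2 hb
    calc m - δ = a * (m - δ) + b * (m - δ) := by rw [← add_mul, hab, one_mul]
      _ ≤ _ := add_le_add h1 h2

theorem sub_mul_self_nonneg {c : A} (h0 : 0 ≤ c) (h1 : c ≤ 1) : 0 ≤ c - c * c := by
  have hc : IsSelfAdjoint c := .of_nonneg h0
  have e : c - c * c = c * (1 - c) * c + (1 - c) * c * (1 - c) := by noncomm_ring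
  rw [e]
  exact add_nonneg (hc.conjugate_nonneg (sub_nonneg.2 h1))
    (((IsSelfAdjoint.one A).sub hc).conjugate_nonneg h0)

theorem sub_conjugate_nonneg {c d : A} (hc0 : 0 ≤ c) (hc1 : c ≤ 1) (hd1 : d ≤ 1) :
    0 ≤ c - c * d * c := by
  have e : c - c * d * c = (c - c * c) + c * (1 - d) * c := by noncomm_ring
  rw [e]
  exact add_nonneg (sub_mul_self_nonneg hc0 hc1)
    ((IsSelfAdjoint.of_nonneg hc0).conjugate_nonneg (sub_nonneg.2 hd1))

variable {J : TwoSidedIdeal A} {g : A →ₗ[ℝ] ℝ} {m : ℝ}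

theorem unitary_conj_mem_almostMaximizers (hJ : IsClosed (J : Set A))
    (hg : ∀ x ∈ J, g (star x * x) = g (x * star x)) {δ : ℝ} {c : A}
    (hc : c ∈ almostMaximizers J g m δ) (u : unitary A) :
    (u : A) * c * star (u : A) ∈ almostMaximizers J g m δ := by
  refine ⟨J.mul_mem_right _ _ (J.mul_mem_left _ _ hc.1), star_right_conjugate_nonneg hc.2.1 _,
    ?_, ?_⟩
  · simpa using star_right_conjugate_le_conjugate hc.2.2.1 (u : A)
  · have hs := CFC.sqrt_mul_sqrt_self c hc.2.1
    have hss : star (CFC.sqrt c) = CFC.sqrt c := (CFC.sqrt_nonneg c).star_eq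
    have hsJ : CFC.sqrt c ∈ J := mem_of_star_mul_self_mem hJ (by rw [hss, hs]; exact hc.1)
    have h := hg (CFC.sqrt c * star (u : A)) (J.mul_mem_right _ _ hsJ)
    have e1 : star (CFC.sqrt c * star (u : A)) * (CFC.sqrt c * star (u : A))
        = (u : A) * c * star (u : A) := by
      rw [star_mul, star_star, hss]
      conv_rhs => rw [← hs]
      noncomm_ring
    have e2 : CFC.sqrt c * star (u : A) * star (CFC.sqrt c * star (u : A)) = c := by
      rw [star_mul, star_star, hss, mul_assoc, ← mul_assoc (star (u : A)),
        Unitary.coe_star_mul_self, one_mul, hs]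
    rw [e1, e2] at h
    rw [h]
    exact hc.2.2.2

/-- Almost maximizers are almost closed under `(c, d) ↦ c * d * c`. -/
theorem conj_mem_almostMaximizers (hm : ∀ c ∈ J, 0 ≤ c → c ≤ 1 → g c ≤ m)
    (hg : ∀ x ∈ J, g (star x * x) = g (x * star x)) {δ : ℝ} {c d : A}
    (hc : c ∈ almostMaximizers J g m δ) (hd : d ∈ almostMaximizers J g m δ) :
    c * d * c ∈ almostMaximizers J g m (3 * δ) := by
  obtain ⟨hcJ, hc0, hc1, hcg⟩ := hc
  obtain ⟨hdJ, hd0, hd1, hdg⟩ := hd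
  have hcs : IsSelfAdjoint c := .of_nonneg hc0
  have hle : c * d * c ≤ c := sub_nonneg.1 (sub_conjugate_nonneg hc0 hc1 hd1)
  refine ⟨J.mul_mem_left _ _ hcJ, hcs.conjugate_nonneg hd0, hle.trans hc1, ?_⟩
  -- an element `y ≤ 1 - d` of the ideal can be added to `d`, so that `g y ≤ δ`
  have hadd : ∀ d ∈ J, 0 ≤ d → m - δ ≤ g d → ∀ y ∈ J, 0 ≤ y → y ≤ 1 - d → g y ≤ δ := by
    intro d hdJ hd0 hdg y hyJ hy0 hy1
    have := hm (d + y) (J.add_mem hdJ hyJ) (add_nonneg hd0 hy0) (by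
      rw [add_comm]; exact le_sub_iff_add_le.1 hy1)
    rw [map_add] at this
    linarith
  have h1 : g (c - c * c) ≤ δ := by
    refine hadd c hcJ hc0 hcg _ (J.sub_mem hcJ (J.mul_mem_left _ _ hcJ))
      (sub_mul_self_nonneg hc0 hc1) ?_
    rw [← sub_nonneg]
    have : 1 - c - (c - c * c) = (1 - c) * 1 * (1 - c) := by noncomm_ring
    rw [this]
    exact ((IsSelfAdjoint.one A).sub hcs).conjugate_nonneg zero_le_one
  have h2 : g (c * (1 - d) * c) ≤ δ := by
    have hs := CFC.sqrt_mul_sqrt_self (1 - d) (sub_nonneg.2 hd1)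
    have hss : star (CFC.sqrt (1 - d)) = CFC.sqrt (1 - d) := (CFC.sqrt_nonneg _).star_eq
    have h := hg (CFC.sqrt (1 - d) * c) (J.mul_mem_left _ _ hcJ)
    have e1 : star (CFC.sqrt (1 - d) * c) * (CFC.sqrt (1 - d) * c) = c * (1 - d) * c := by
      rw [star_mul, hss, hcs.star_eq]
      conv_rhs => rw [← hs]
      noncomm_ring
    have e2 : CFC.sqrt (1 - d) * c * star (CFC.sqrt (1 - d) * c)
        = CFC.sqrt (1 - d) * (c * c) * CFC.sqrt (1 - d) := by
      rw [star_mul, hss, hcs.star_eq]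
      noncomm_ring
    rw [e1, e2] at h
    rw [h]
    have hcc : c * c ≤ 1 := (sub_nonneg.1 (sub_mul_self_nonneg hc0 hc1)).trans hc1
    have hcc0 : 0 ≤ c * c := by simpa using hcs.conjugate_nonneg (zero_le_one (α := A))
    refine hadd d hdJ hd0 hdg _ (J.mul_mem_right _ _ (J.mul_mem_left _ _ (J.mul_mem_left _ _ hcJ)))
      (conjugate_nonneg_of_nonneg hcc0 (CFC.sqrt_nonneg _)) ?_
    have := conjugate_le_conjugate_of_nonneg hcc (CFC.sqrt_nonneg (1 - d))
    rwa [mul_one, hs] at this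
  have e : c * d * c = c - (c - c * c) - c * (1 - d) * c := by noncomm_ring
  rw [e, map_sub, map_sub]
  linarith

/-- A positive functional `ψ` has almost maximizers `c` that nearly minimize it: `ψ` cannot tell `c`
from `c * d * c` for any other almost maximizer `d`. The infima of `ψ` over the almost maximizers to
within `δ * 3⁻ⁿ` increase with `n` and are bounded, so two consecutive ones are close. -/
theorem exists_minimizing_almostMaximizer (hm : ∀ c ∈ J, 0 ≤ c → c ≤ 1 → g c ≤ m)
    (hne : ∀ δ > 0, (almostMaximizers J g m δ).Nonempty)
    (hg : ∀ x ∈ J, g (star x * x) = g (x * star x))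
    (ψ : A →ₗ[ℝ] ℝ) (hψ : ∀ y, 0 ≤ y → 0 ≤ ψ y) {δ η : ℝ} (hδ : 0 < δ) (hη : 0 < η) :
    ∃ δ' ≤ δ, ∃ c ∈ almostMaximizers J g m δ',
      ∀ d ∈ almostMaximizers J g m δ', ψ (c - c * d * c) ≤ η := by
  let ν : ℕ → ℝ := fun n => sInf (ψ '' almostMaximizers J g m (δ * (1 / 3) ^ n))
  have hpos : ∀ n : ℕ, 0 < δ * (1 / 3 : ℝ) ^ n := fun n => by positivity
  have hbdd : ∀ n, BddBelow (ψ '' almostMaximizers J g m (δ * (1 / 3) ^ n)) := fun n =>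
    ⟨0, by rintro _ ⟨c, hc, rfl⟩; exact hψ c hc.2.1⟩
  have hmono : Monotone ν := monotone_nat_of_le_succ fun n => by
    refine csInf_le_csInf (hbdd n) ((hne _ (hpos _)).image _) (Set.image_mono ?_)
    refine almostMaximizers_mono ?_
    rw [pow_succ]
    nlinarith [hpos n]
  have hub : BddAbove (Set.range ν) := ⟨ψ 1, by
    rintro _ ⟨n, rfl⟩
    obtain ⟨c, hc⟩ := hne _ (hpos n)
    refine (csInf_le (hbdd n) ⟨c, hc, rfl⟩).trans ?_
    have := hψ _ (sub_nonneg.2 hc.2.2.1)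
    rw [map_sub] at this
    linarith⟩
  have hconv := tendsto_atTop_ciSup hmono hub
  obtain ⟨n, hn⟩ : ∃ n, ν (n + 1) - ν n < η / 2 := by
    have h := (((tendsto_add_atTop_iff_nat 1).2 hconv).sub hconv)
    rw [sub_self] at h
    exact (h.eventually (gt_mem_nhds (half_pos hη))).exists
  obtain ⟨_, ⟨c, hc, rfl⟩, hcν⟩ := exists_lt_of_csInf_lt ((hne _ (hpos (n + 1))).image ψ)
    (lt_add_of_pos_right (ν (n + 1)) (half_pos hη))
  refine ⟨δ * (1 / 3) ^ (n + 1), ?_, c, hc, fun d hd => ?_⟩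
  · exact mul_le_of_le_one_right hδ.le (pow_le_one₀ (by norm_num) (by norm_num))
  · have h1 := conj_mem_almostMaximizers hm hg hc hd
    have e : 3 * (δ * (1 / 3 : ℝ) ^ (n + 1)) = δ * (1 / 3) ^ n := by rw [pow_succ]; ring
    rw [e] at h1
    have h2 : ν n ≤ ψ (c * d * c) := csInf_le (hbdd n) ⟨_, h1, rfl⟩
    rw [map_sub]
    linarith

/-- If the positive functional `φ` does not distinguish `c` from `c * e * c`, nor `e` from
`e * c * e`, then `c` and `e` are close in the `2`-norm of `φ`. -/
theorem sq_sub_le_of_conj_close {φ : A →ₗ[ℝ] ℝ} (hφ : ∀ y, 0 ≤ y → 0 ≤ φ y) {c e : A}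
    (hc0 : 0 ≤ c) (hc1 : c ≤ 1) (he0 : 0 ≤ e) (he1 : e ≤ 1) {η s : ℝ} (hs : 0 < s)
    (h1 : φ (c - c * e * c) ≤ η) (h2 : φ (e - e * c * e) ≤ η) :
    φ ((e - c) * (e - c)) ≤ s⁻¹ * φ 1 + s * η := by
  have key : ∀ c e : A, 0 ≤ c → c ≤ 1 → 0 ≤ e → e ≤ 1 → φ (c - c * e * c) ≤ η →
      φ (c * (1 - e) + (1 - e) * c) ≤ s⁻¹ * φ 1 + s * η := by
    intro c e hc0 hc1 he0 he1 h
    have hcs : IsSelfAdjoint c := .of_nonneg hc0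
    have i1 : φ (c * (1 - e) * c) ≤ η := by
      have := hφ _ (sub_mul_self_nonneg hc0 hc1)
      have e1 : c - c * e * c = (c - c * c) + c * (1 - e) * c := by noncomm_ring
      rw [e1, map_add] at h
      linarith
    have i2 : 0 ≤ φ ((1 - s • c) * (1 - e) * (1 - s • c)) :=
      hφ _ (((IsSelfAdjoint.one A).sub ((IsSelfAdjoint.all s).smul hcs)).conjugate_nonneg
        (sub_nonneg.2 he1))
    have i3 : φ (1 - e) ≤ φ 1 := by rw [map_sub]; linarith [hφ e he0]
    have e2 : (1 - s • c) * (1 - e) * (1 - s • c)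
        = (1 - e) - s • (c * (1 - e) + (1 - e) * c) + (s * s) • (c * (1 - e) * c) := by
      simp only [sub_mul, mul_sub, smul_mul_assoc, mul_smul_comm, one_mul, mul_one, smul_sub,
        smul_add, mul_smul]
      abel
    rw [e2, map_add, map_sub, map_smul, map_smul, smul_eq_mul, smul_eq_mul] at i2
    have i4 : s * φ (c * (1 - e) + (1 - e) * c) ≤ φ 1 + s * s * η := by
      have := mul_le_mul_of_nonneg_left i1 (mul_pos hs hs).le
      linarith
    rw [← mul_le_mul_iff_right₀ hs]
    refine i4.trans (le_of_eq ?_)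
    field_simp
  have k1 := key c e hc0 hc1 he0 he1 h1
  have k2 := key e c he0 he1 hc0 hc1 h2
  have p1 := hφ _ (sub_mul_self_nonneg hc0 hc1)
  have p2 := hφ _ (sub_mul_self_nonneg he0 he1)
  have e3 : (2 : ℝ) • ((e - c) * (e - c)) =
      (c * (1 - e) + (1 - e) * c) + (e * (1 - c) + (1 - c) * e)
      - (2 : ℝ) • (c - c * c) - (2 : ℝ) • (e - e * e) := by
    simp only [two_smul]
    noncomm_ring
  have := congr_arg φ e3
  simp only [map_sub, map_add, map_smul, smul_eq_mul] at this k1 k2 p1 p2 ⊢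
  linarith

/-- For a positive functional `φ` and finitely many unitaries `u`, there are almost maximizers that
are close to all their conjugates by the `u` in the `2`-norm of `φ`. -/
theorem exists_almostMaximizer_conj_close (hJ : IsClosed (J : Set A))
    (hm : ∀ c ∈ J, 0 ≤ c → c ≤ 1 → g c ≤ m)
    (hne : ∀ δ > 0, (almostMaximizers J g m δ).Nonempty)
    (hg : ∀ x ∈ J, g (star x * x) = g (x * star x))
    (φ : A →ₗ[ℝ] ℝ) (hφ : ∀ y, 0 ≤ y → 0 ≤ φ y) (U : Finset (unitary A)) {δ ε : ℝ} (hδ : 0 < δ)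
    (hε : 0 < ε) :
    ∃ c ∈ almostMaximizers J g m δ, ∀ u ∈ U,
      φ ((star (u : A) * c * u - c) * (star (u : A) * c * u - c)) ≤ ε := by
  let conj : unitary A → A →ₗ[ℝ] A := fun u =>
    LinearMap.mulLeft ℝ (star (u : A)) ∘ₗ LinearMap.mulRight ℝ (u : A)
  have hconj : ∀ u x, conj u x = star (u : A) * x * u := fun u x => by simp [conj, mul_assoc]
  have hconj0 : ∀ u x, 0 ≤ x → 0 ≤ φ (conj u x) := fun u x hx => by
    rw [hconj]; exact hφ _ (star_left_conjugate_nonneg hx _)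
  let ψ : A →ₗ[ℝ] ℝ := φ + ∑ u ∈ U, φ ∘ₗ conj u
  have hψe : ∀ x, ψ x = φ x + ∑ u ∈ U, φ (conj u x) := fun x => by simp [ψ]
  have hψ : ∀ y, 0 ≤ y → 0 ≤ ψ y := fun y hy => by
    rw [hψe]; exact add_nonneg (hφ y hy) (Finset.sum_nonneg fun u _ => hconj0 u y hy)
  have hφ1 : 0 ≤ φ 1 := hφ 1 zero_le_one
  set s : ℝ := 2 * (φ 1 + 1) / ε with hs
  have hs0 : 0 < s := by positivity
  obtain ⟨δ', hδ', c, hc, hcd⟩ := exists_minimizing_almostMaximizer hm hne hg ψ hψ hδ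
    (show 0 < ε / (2 * s) by positivity)
  refine ⟨c, almostMaximizers_mono hδ' hc, fun u hu => ?_⟩
  have hd1 := unitary_conj_mem_almostMaximizers hJ hg hc u
  have hd2 := unitary_conj_mem_almostMaximizers hJ hg hc (star u)
  rw [Unitary.coe_star, star_star] at hd2
  set e : A := star (u : A) * c * u with he
  have h1 : φ (c - c * e * c) ≤ ε / (2 * s) := by
    refine le_trans ?_ (hcd _ hd2)
    rw [hψe]
    exact le_add_of_nonneg_right (Finset.sum_nonneg fun v _ =>
      hconj0 v _ (sub_conjugate_nonneg hc.2.1 hc.2.2.1 hd2.2.2.1))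
  have h2 : φ (e - e * c * e) ≤ ε / (2 * s) := by
    refine le_trans ?_ (hcd _ hd1)
    have hnn := sub_conjugate_nonneg hc.2.1 hc.2.2.1 hd1.2.2.1
    have e1 : e - e * c * e = conj u (c - c * ((u : A) * c * star (u : A)) * c) := by
      rw [hconj, he]
      simp only [mul_sub, sub_mul, mul_assoc]
    rw [hψe, e1]
    exact (Finset.single_le_sum
      (f := fun v => φ (conj v (c - c * ((u : A) * c * star (u : A)) * c)))
      (fun v _ => hconj0 v _ hnn) hu).trans (le_add_of_nonneg_left (hφ _ hnn))
  refine (sq_sub_le_of_conj_close hφ hc.2.1 hc.2.2.1 hd2.2.1 hd2.2.2.1 hs0 h1 h2).trans ?_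
  have e2 : s * (ε / (2 * s)) = ε / 2 := by field_simp
  have e3 : s⁻¹ * φ 1 ≤ ε / 2 := by
    rw [hs, inv_div, div_mul_eq_mul_div, div_le_iff₀ (by positivity)]
    nlinarith
  linarith

/-- There are almost maximizers whose commutators with finitely many given unitaries are small in
norm. The commutators with the almost maximizers form a convex set, so it is enough to make each
functional small on it. -/
theorem exists_almostMaximizer_commutator_lt (hJ : IsClosed (J : Set A))
    (hm : ∀ c ∈ J, 0 ≤ c → c ≤ 1 → g c ≤ m)
    (hne : ∀ δ > 0, (almostMaximizers J g m δ).Nonempty)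
    (hg : ∀ x ∈ J, g (star x * x) = g (x * star x))
    (U : Finset (unitary A)) {δ ε : ℝ} (hδ : 0 < δ) (hε : 0 < ε) :
    ∃ c ∈ almostMaximizers J g m δ, ∀ u ∈ U, ‖c * (u : A) - (u : A) * c‖ < ε := by
  classical
  let D : A →ₗ[ℝ] (U → A) := LinearMap.pi fun u =>
    LinearMap.mulRight ℝ ((u : unitary A) : A) - LinearMap.mulLeft ℝ ((u : unitary A) : A)
  have hD : ∀ c u, D c u = c * ((u : unitary A) : A) - ((u : unitary A) : A) * c := fun c u => by
    simp [D]
  have hconv : Convex ℝ (D '' almostMaximizers J g m δ) :=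
    (convex_almostMaximizers J g m δ).is_linear_image D.isLinear
  suffices h0 : (0 : U → A) ∈ closure (D '' almostMaximizers J g m δ) by
    obtain ⟨_, ⟨c, hc, rfl⟩, hcε⟩ := Metric.mem_closure_iff.1 h0 ε hε
    refine ⟨c, hc, fun u hu => ?_⟩
    rw [dist_comm, dist_zero_right, pi_norm_lt_iff hε] at hcε
    simpa only [hD] using hcε ⟨u, hu⟩
  by_contra h0
  obtain ⟨f, s, hs0, hs⟩ := geometric_hahn_banach_point_closed hconv.closure isClosed_closure h0
  rw [map_zero] at hs0
  let fu : U → A →L[ℝ] ℝ := fun u => (f.comp (ContinuousLinearMap.single ℝ (fun _ : U => A) u)).comp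
    (ContinuousLinearMap.mul ℝ A ((u : unitary A) : A))
  have hfu : ∀ c, f (D c) =
      ∑ u : U, fu u (star ((u : unitary A) : A) * c * ((u : unitary A) : A) - c) := by
    intro c
    have : D c = ∑ u : U, Pi.single u (D c u) := (Finset.univ_sum_single (D c)).symm
    rw [this, map_sum]
    refine Finset.sum_congr rfl fun u _ => ?_
    change _ = f (Pi.single u (((u : unitary A) : A) *
      (star ((u : unitary A) : A) * c * ((u : unitary A) : A) - c)))
    rw [hD, mul_sub, ← mul_assoc, ← mul_assoc, Unitary.mul_star_self_of_mem u.1.2, one_mul]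
  choose φ hφ hφf using fun u => exists_positive_dominating (fu u)
  let Φ : A →ₗ[ℝ] ℝ := ∑ u, φ u
  have hΦe : ∀ x, Φ x = ∑ u, φ u x := fun x => by simp [Φ]
  have hΦ : ∀ y, 0 ≤ y → 0 ≤ Φ y := fun y hy => by
    rw [hΦe]; exact Finset.sum_nonneg fun u _ => hφ u y hy
  have hφΦ : ∀ u y, 0 ≤ y → φ u y ≤ Φ y := fun u y hy => by
    rw [hΦe]
    exact Finset.single_le_sum (f := fun u => φ u y) (fun u _ => hφ u y hy) (Finset.mem_univ u)
  have hΦ1 := hΦ 1 zero_le_one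
  -- the square is completed with a weight `r` for which `r * Φ 1 ≤ s`
  set r : ℝ := s / (Φ 1 + 1) with hr
  have hr0 : 0 < r := by positivity
  have hrs : r * Φ 1 ≤ s := by
    rw [hr, div_mul_eq_mul_div, div_le_iff₀ (by positivity)]
    nlinarith
  obtain ⟨c, hc, hcu⟩ := exists_almostMaximizer_conj_close hJ hm hne hg Φ hΦ U hδ
    (show 0 < r * s / (U.card + 1) by positivity)
  have hlt := hs _ (subset_closure ⟨c, hc, rfl⟩)
  rw [hfu] at hlt
  have hcs : IsSelfAdjoint c := .of_nonneg hc.2.1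
  have h2 : ∀ u : U, 2 * fu u (star ((u : unitary A) : A) * c * ((u : unitary A) : A) - c)
      ≤ r * φ u 1 + s / (U.card + 1) := by
    intro u
    have hsa : IsSelfAdjoint (star ((u : unitary A) : A) * c * ((u : unitary A) : A) - c) :=
      (hcs.conjugate' _).sub hcs
    refine (hφf u _ hsa r hr0).trans (add_le_add le_rfl ?_)
    have hnn := (hφΦ u _ (by
      have := star_mul_self_nonneg (star ((u : unitary A) : A) * c * ((u : unitary A) : A) - c)
      rwa [hsa.star_eq] at this)).trans (hcu u u.2)
    calc _ ≤ r⁻¹ * (r * s / (U.card + 1)) := mul_le_mul_of_nonneg_left hnn (by positivity)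
      _ = _ := by field_simp
  have h3 := Finset.sum_le_sum fun u (_ : u ∈ Finset.univ) => h2 u
  rw [Finset.sum_add_distrib, ← Finset.mul_sum, ← Finset.mul_sum, ← hΦe, Finset.sum_const,
    Finset.card_univ, Fintype.card_coe, nsmul_eq_mul] at h3
  have h4 : (U.card : ℝ) * (s / (U.card + 1)) ≤ s := by
    rw [mul_div_assoc', div_le_iff₀ (by positivity)]
    nlinarith
  linarith

end Order

section Order

variable [PartialOrder A] [StarOrderedRing A] {J : TwoSidedIdeal A} {g : A →ₗ[ℝ] ℝ} {m : ℝ}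

/-- There are almost maximizers that almost commute, uniformly, with a given compact family of
elements. -/
theorem exists_almostMaximizer_commutator_le (hJ : IsClosed (J : Set A))
    (hm : ∀ c ∈ J, 0 ≤ c → c ≤ 1 → g c ≤ m)
    (hne : ∀ δ > 0, (almostMaximizers J g m δ).Nonempty)
    (hg : ∀ x ∈ J, g (star x * x) = g (x * star x))
    {T : Set A} (hT : IsCompact T) {δ ε : ℝ} (hδ : 0 < δ) (hε : 0 < ε) :
    ∃ c ∈ almostMaximizers J g m δ, ∀ a ∈ T, ‖c * a - a * c‖ ≤ ε := by
  classical
  -- a net of almost maximizers asymptotically commuting with every unitary, hence with all of `A`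
  choose c hc hcu using fun p : Finset (unitary A) × ℕ =>
    exists_almostMaximizer_commutator_lt hJ hm hne hg p.1 hδ
      (Nat.one_div_pos_of_nat (α := ℝ) (n := p.2))
  have hc1 : ∀ p, ‖c p‖ ≤ 1 := fun p =>
    (CStarAlgebra.norm_le_one_iff_of_nonneg _ (hc p).2.1).2 (hc p).2.2.1
  let S : Submodule ℂ A :=
    { carrier := {a | Tendsto (fun p => c p * a - a * c p) atTop (𝓝 0)}
      add_mem' := fun {a b} ha hb => by
        have := Tendsto.add ha hb
        rw [add_zero] at this
        refine this.congr fun p => ?_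
        noncomm_ring
      zero_mem' := by simp
      smul_mem' := fun z a ha => by
        have := Tendsto.const_smul ha z
        rw [smul_zero] at this
        refine this.congr fun p => ?_
        rw [smul_sub, mul_smul_comm, smul_mul_assoc] }
  have hS : S = ⊤ := by
    rw [eq_top_iff, ← CStarAlgebra.span_unitary A, Submodule.span_le]
    intro u hu
    change Tendsto (fun p => c p * u - u * c p) atTop (𝓝 0)
    rw [Metric.tendsto_nhds]
    intro ρ hρ
    obtain ⟨n, hn⟩ := exists_nat_one_div_lt hρ
    filter_upwards [eventually_ge_atTop (({⟨u, hu⟩} : Finset (unitary A)), n)] with p hp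
    rw [dist_zero_right]
    refine (hcu p ⟨u, hu⟩ (hp.1 (by simp))).trans_le (le_trans ?_ hn.le)
    exact Nat.one_div_le_one_div hp.2
  obtain ⟨t, -, htf, htT⟩ := hT.finite_cover_balls (show 0 < ε / 4 by positivity)
  have hev : ∀ᶠ p in atTop, ∀ a ∈ t, ‖c p * a - a * c p‖ < ε / 2 := by
    refine (eventually_all_finite htf).2 fun a _ => ?_
    have ha : a ∈ S := hS ▸ Submodule.mem_top
    have := (Metric.tendsto_nhds.1 ha) (ε / 2) (by positivity)
    simpa only [dist_zero_right] using this
  obtain ⟨p, hp⟩ := hev.exists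
  refine ⟨c p, hc p, fun a ha => ?_⟩
  obtain ⟨b, hb, hab⟩ := Set.mem_iUnion₂.1 (htT ha)
  rw [Metric.mem_ball, dist_eq_norm] at hab
  have e : c p * a - a * c p = (c p * b - b * c p) + (c p * (a - b) - (a - b) * c p) := by
    noncomm_ring
  have h1 : ‖c p * (a - b) - (a - b) * c p‖ ≤ ‖a - b‖ + ‖a - b‖ := by
    refine (norm_sub_le _ _).trans (add_le_add ?_ ?_)
    · exact (norm_mul_le _ _).trans (mul_le_of_le_one_left (norm_nonneg _) (hc1 p))
    · exact (norm_mul_le _ _).trans (mul_le_of_le_one_right (norm_nonneg _) (hc1 p))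
  rw [e]
  refine (norm_add_le _ _).trans ?_
  linarith [hp b hb]

end Order

/-- The commutators of `x` with the elements of a continuous family `α`. -/
def commutatorFamily {K : Type*} [TopologicalSpace K] [CompactSpace K] (α : C(K, A)) :
    A →ₗ[ℝ] C(K, A) where
  toFun x := ContinuousMap.const K x * α - α * ContinuousMap.const K x
  map_add' x y := by ext t; simp [add_mul, mul_add]; abel
  map_smul' r x := by ext t; simp [smul_sub]

@[simp]
theorem commutatorFamily_apply {K : Type*} [TopologicalSpace K] [CompactSpace K] (α : C(K, A))
    (x : A) (t : K) : commutatorFamily α x t = x * α t - α t * x := rfl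

/-- A bounded trace on a closed ideal `J` which is a combination of functionals
`x ↦ f (x * a - a * x)` vanishes: its supremum on the positive part of the unit ball is nearly
attained at elements almost commuting with all the `a`. -/
theorem trace_of_commutators_eq_zero {J : TwoSidedIdeal A} (hJ : IsClosed (J : Set A)) {K : Type*}
    [TopologicalSpace K] [CompactSpace K] (α : C(K, A)) (f : C(K, A) →L[ℝ] ℝ)
    (hf : ∀ x ∈ J, f (commutatorFamily α (star x * x)) = f (commutatorFamily α (x * star x)))
    {h : A} (hh : h ∈ J) (hsa : IsSelfAdjoint h) : f (commutatorFamily α h) = 0 := by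
  let := CStarAlgebra.spectralOrder A
  have := CStarAlgebra.spectralOrderedRing A
  have key : ∀ f : C(K, A) →L[ℝ] ℝ,
      (∀ x ∈ J, f (commutatorFamily α (star x * x)) = f (commutatorFamily α (x * star x))) →
      ∀ c ∈ J, 0 ≤ c → c ≤ 1 → f (commutatorFamily α c) ≤ 0 := by
    intro f hf c hcJ hc0 hc1
    let g : A →ₗ[ℝ] ℝ := f.toLinearMap ∘ₗ commutatorFamily α
    let S : Set A := {c | c ∈ J ∧ 0 ≤ c ∧ c ≤ 1}
    have hbound : ∀ x ∈ S, ‖commutatorFamily α x‖ ≤ 2 * ‖α‖ := by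
      intro x hx
      have hx1 := (CStarAlgebra.norm_le_one_iff_of_nonneg _ hx.2.1).2 hx.2.2
      refine (ContinuousMap.norm_le _ (by positivity)).2 fun t => ?_
      have ht := α.norm_coe_le_norm t
      rw [commutatorFamily_apply, two_mul]
      refine (norm_sub_le _ _).trans (add_le_add ?_ ?_)
      · exact (norm_mul_le _ _).trans ((mul_le_of_le_one_left (norm_nonneg _) hx1).trans ht)
      · exact (norm_mul_le _ _).trans ((mul_le_of_le_one_right (norm_nonneg _) hx1).trans ht)
    have hbdd : BddAbove (g '' S) := by
      refine ⟨‖f‖ * (2 * ‖α‖), ?_⟩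
      rintro _ ⟨x, hx, rfl⟩
      exact (le_abs_self _).trans ((f.le_opNorm _).trans
        (mul_le_mul_of_nonneg_left (hbound x hx) (norm_nonneg _)))
    set m := sSup (g '' S) with hm
    have hSne : (g '' S).Nonempty := ⟨_, c, ⟨hcJ, hc0, hc1⟩, rfl⟩
    have hgm : ∀ c ∈ J, 0 ≤ c → c ≤ 1 → g c ≤ m := fun c h1 h2 h3 =>
      le_csSup hbdd ⟨c, ⟨h1, h2, h3⟩, rfl⟩
    have hne : ∀ δ > 0, (almostMaximizers J g m δ).Nonempty := by
      intro δ hδ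
      obtain ⟨_, ⟨d, hd, rfl⟩, hlt⟩ := exists_lt_of_lt_csSup hSne (sub_lt_self m hδ)
      exact ⟨d, hd.1, hd.2.1, hd.2.2, hlt.le⟩
    refine (hgm c hcJ hc0 hc1).trans (le_of_forall_pos_le_add fun ε hε => ?_)
    obtain ⟨d, hd, hdα⟩ := exists_almostMaximizer_commutator_le hJ hgm hne hf
      (isCompact_range α.continuous) (half_pos hε)
      (show 0 < ε / (2 * (‖f‖ + 1)) by positivity)
    have h1 : ‖commutatorFamily α d‖ ≤ ε / (2 * (‖f‖ + 1)) :=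
      (ContinuousMap.norm_le _ (by positivity)).2 fun t => hdα _ ⟨t, rfl⟩
    have h2 : g d ≤ ‖f‖ * (ε / (2 * (‖f‖ + 1))) := (le_abs_self _).trans
      ((f.le_opNorm _).trans (mul_le_mul_of_nonneg_left h1 (norm_nonneg _)))
    have h3 : ‖f‖ * (ε / (2 * (‖f‖ + 1))) ≤ ε / 2 := by
      rw [mul_div_assoc', div_le_div_iff₀ (by positivity) (by positivity)]
      nlinarith [norm_nonneg f]
    linarith [hd.2.2.2]
  have key' : ∀ c ∈ J, 0 ≤ c → f (commutatorFamily α c) = 0 := by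
    intro c hcJ hc0
    have hpos : 0 < ‖c‖ + 1 := by positivity
    have h1 : (‖c‖ + 1)⁻¹ • c ≤ 1 := by
      refine (CStarAlgebra.norm_le_one_iff_of_nonneg _ (smul_nonneg (by positivity) hc0)).1 ?_
      rw [norm_smul, norm_inv, Real.norm_of_nonneg hpos.le, inv_mul_le_one₀ hpos]
      linarith
    have h0 : 0 ≤ (‖c‖ + 1)⁻¹ • c := smul_nonneg (by positivity) hc0
    have hJ' : (‖c‖ + 1)⁻¹ • c ∈ J := smul_mem_ideal J _ hcJ
    have h2 := key f hf _ hJ' h0 h1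
    have h3 := key (-f) (fun x hx => by simp [hf x hx]) _ hJ' h0 h1
    rw [neg_apply] at h3
    have h4 : (‖c‖ + 1)⁻¹ * f (commutatorFamily α c) = 0 := by
      rw [map_smul, map_smul, smul_eq_mul] at h2 h3
      linarith
    exact (mul_eq_zero.1 h4).resolve_left (by positivity)
  have e := CFC.posPart_sub_negPart h hsa
  have hp : h⁺ ∈ J := cfcₙ_mem_ideal hJ (·⁺ : ℝ → ℝ) hh
  have hn : h⁻ ∈ J := cfcₙ_mem_ideal hJ (·⁻ : ℝ → ℝ) hh
  rw [← e, map_sub, map_sub, key' _ hp (CFC.posPart_nonneg h), key' _ hn (CFC.negPart_nonneg h),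
    sub_zero]

/-- On a compact family of elements, the derivation given by a self-adjoint element of `J` is
approximated by derivations given by elements of any real subspace `W` that contains the
commutators `star x * x - x * star x` with `x ∈ J`. -/
theorem exists_commutatorFamily_close {J : TwoSidedIdeal A} (hJ : IsClosed (J : Set A))
    {W : Submodule ℝ A} (hW : ∀ x ∈ J, star x * x - x * star x ∈ W) {K : Type*}
    [TopologicalSpace K] [CompactSpace K] (α : C(K, A)) {h : A} (hh : h ∈ J)
    (hsa : IsSelfAdjoint h) {ε : ℝ} (hε : 0 < ε) :
    ∃ k ∈ W, ∀ t, ‖(h - k) * α t - α t * (h - k)‖ < ε := by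
  suffices h0 : commutatorFamily α h ∈ (W.map (commutatorFamily α)).topologicalClosure by
    obtain ⟨_, ⟨k, hk, rfl⟩, hkε⟩ := Metric.mem_closure_iff.1 h0 ε hε
    refine ⟨k, hk, fun t => ?_⟩
    rw [dist_eq_norm, ← map_sub] at hkε
    exact (ContinuousMap.norm_coe_le_norm _ t).trans_lt hkε
  by_contra h0
  obtain ⟨f, s, hfs, hs⟩ := geometric_hahn_banach_closed_point
    (W.map (commutatorFamily α)).topologicalClosure.convex
    (Submodule.isClosed_topologicalClosure _) h0
  have hfW : ∀ k ∈ W, f (commutatorFamily α k) = 0 := by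
    intro k hk
    by_contra hne
    -- a linear functional bounded above on a subspace vanishes there
    have := hfs (commutatorFamily α ((s / f (commutatorFamily α k)) • k))
      (subset_closure ⟨_, W.smul_mem _ hk, rfl⟩)
    rw [map_smul, map_smul, smul_eq_mul, div_mul_cancel₀ _ hne] at this
    exact lt_irrefl _ this
  have h1 := trace_of_commutators_eq_zero hJ α f (fun x hx => by
    have := hfW _ (hW x hx)
    rwa [map_sub, map_sub, sub_eq_zero] at this) hh hsa
  have h2 := hfs 0 (Submodule.zero_mem _)
  rw [map_zero] at h2
  linarith

/-! ### One-parameter groups of unitaries -/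

/-- The unitary `exp (i Re x)`. Defining it for all `x`, and not only for self-adjoint ones, lets
the infinitesimal generators of a group of automorphisms form a complex subspace. -/
def expU (x : A) : unitary A := selfAdjoint.expUnitary (realPart x)

theorem coe_expU (x : A) : (expU x : A) = NormedSpace.exp (I • (realPart x : A)) := rfl

theorem continuous_expU : Continuous (expU : A → unitary A) := by
  refine selfAdjoint.continuous_expUnitary.comp (continuous_induced_rng.2 ?_)
  have : (Subtype.val ∘ realPart : A → A) = fun x => (2 : ℝ)⁻¹ • (x + star x) :=
    funext fun x => realPart_apply_coe x
  rw [this]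
  fun_prop

@[simp]
theorem expU_zero : expU (0 : A) = 1 := by simp [expU]

theorem expU_realPart (x : A) : expU (realPart x : A) = expU x := by
  simp [expU]

theorem expU_of_argSelfAdjoint {u : unitary A} (hu : ‖(u - 1 : A)‖ < 2) :
    expU (Unitary.argSelfAdjoint u : A) = u := by
  rw [expU]
  convert expUnitary_argSelfAdjoint hu
  exact Subtype.ext (Unitary.argSelfAdjoint u).2.coe_realPart

theorem expU_add_smul (s t : ℝ) (x : A) : expU ((s + t) • x) = expU (s • x) * expU (t • x) := by
  rw [expU, expU, expU, add_smul, map_add, Commute.expUnitary_add]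
  rw [map_smul, map_smul, selfAdjoint.val_smul, selfAdjoint.val_smul]
  exact ((Commute.refl _).smul_left s).smul_right t

theorem expU_neg (x : A) : expU (-x) = (expU x)⁻¹ := by
  rw [eq_inv_iff_mul_eq_one]
  have := expU_add_smul (-1) 1 x
  simpa using this.symm

theorem expU_natCast_smul (n : ℕ) (x : A) : expU ((n : ℝ) • x) = expU x ^ n := by
  induction n with
  | zero => simp
  | succ n ih => rw [Nat.cast_succ, expU_add_smul, ih, one_smul, pow_succ]

theorem expU_eq_pow (n : ℕ) (x : A) : expU x = expU ((1 / ((n : ℝ) + 1)) • x) ^ (n + 1) := by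
  rw [← expU_natCast_smul, smul_smul, Nat.cast_succ, mul_one_div_cancel (by positivity), one_smul]

theorem coe_expU_neg (x : A) : (expU (-x) : A) = star (expU x : A) := by
  rw [expU_neg]
  rfl

theorem coe_expU_smul (t : ℝ) (x : A) :
    (expU (t • x) : A) = NormedSpace.exp (t • (I • (realPart x : A))) := by
  rw [coe_expU, map_smul, selfAdjoint.val_smul, smul_comm]

theorem hasDerivAt_expU (x : A) (t : ℝ) : HasDerivAt (fun t : ℝ => (expU (t • x) : A))
    ((expU (t • x) : A) * (I • (realPart x : A))) t := by
  simp only [coe_expU_smul]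
  exact hasDerivAt_exp_smul_const (I • (realPart x : A)) t

theorem hasDerivAt_expU' (x : A) (t : ℝ) : HasDerivAt (fun t : ℝ => (expU (t • x) : A))
    ((I • (realPart x : A)) * (expU (t • x) : A)) t := by
  simp only [coe_expU_smul]
  exact hasDerivAt_exp_smul_const' (I • (realPart x : A)) t

theorem hasDerivAt_expU_zero (x : A) : HasDerivAt (fun t : ℝ => (expU (t • x) : A))
    (I • (realPart x : A)) 0 := by
  simpa using hasDerivAt_expU x 0

theorem norm_pow_sub_pow_le (u v : unitary A) (n : ℕ) :
    ‖((u ^ n : unitary A) : A) - (v ^ n : unitary A)‖ ≤ n * ‖(u : A) - v‖ := by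
  induction n with
  | zero => simp
  | succ n ih =>
    have e : ((u ^ (n + 1) : unitary A) : A) - (v ^ (n + 1) : unitary A)
        = (u ^ n : unitary A) * ((u : A) - v)
          + (((u ^ n : unitary A) : A) - (v ^ n : unitary A)) * v := by
      rw [pow_succ, pow_succ, Submonoid.coe_mul, Submonoid.coe_mul]
      noncomm_ring
    rw [e]
    refine (norm_add_le _ _).trans ?_
    rw [CStarRing.norm_coe_unitary_mul, CStarRing.norm_mul_coe_unitary, Nat.cast_succ]
    linarith

/-- The **Lie–Trotter formula** for a curve of unitaries: if `γ` has derivative `i Re x` at `0`,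
then `γ (1 / n) ^ n` tends to `exp (i Re x)`. -/
theorem tendsto_pow_of_hasDerivAt {γ : ℝ → unitary A} {x : A} (h0 : γ 0 = 1)
    (hγ : HasDerivAt (fun t => (γ t : A)) (I • (realPart x : A)) 0) :
    Tendsto (fun n : ℕ => γ (1 / ((n : ℝ) + 1)) ^ (n + 1)) atTop (𝓝 (expU x)) := by
  rw [tendsto_iff_dist_tendsto_zero]
  have hd : HasDerivAt (fun t : ℝ => (γ t : A) - (expU (t • x) : A)) 0 0 := by
    simpa using hγ.fun_sub (hasDerivAt_expU_zero x)
  have hs : Tendsto (fun n : ℕ => 1 / ((n : ℝ) + 1)) atTop (𝓝[≠] 0) := by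
    refine tendsto_nhdsWithin_iff.2 ⟨tendsto_one_div_add_atTop_nhds_zero_nat,
      Eventually.of_forall fun n => ?_⟩
    simp only [Set.mem_compl_iff, Set.mem_singleton_iff]
    positivity
  have hslope := ((hasDerivAt_iff_tendsto_slope_zero.1 hd).comp hs).norm
  rw [norm_zero] at hslope
  refine squeeze_zero (fun _ => dist_nonneg) (fun n => ?_) hslope
  rw [Subtype.dist_eq, dist_eq_norm]
  conv_lhs => rw [expU_eq_pow n x]
  refine (norm_pow_sub_pow_le _ _ _).trans (le_of_eq ?_)
  simp only [Function.comp_apply, zero_add, h0, zero_smul, expU_zero, sub_self, sub_zero, norm_smul]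
  rw [one_div, inv_inv, Real.norm_of_nonneg (by positivity)]
  push_cast
  rfl

/-! ### Infinitesimal generators of a closed group of automorphisms -/

theorem continuous_Ad : Continuous fun u : unitary A => Ad u := by
  refine continuous_aut_iff.2 fun a => ?_
  simp only [Unitary.conjStarAlgAut_apply]
  fun_prop

theorem Ad_expU_mem_of_hasDerivAt {H : Subgroup (A ≃⋆ₐ[ℂ] A)}
    (hH : IsClosed (H : Set (A ≃⋆ₐ[ℂ] A))) {γ : ℝ → unitary A} {x : A} (h0 : γ 0 = 1)
    (hγ : HasDerivAt (fun t => (γ t : A)) (I • (realPart x : A)) 0) (hmem : ∀ t, Ad (γ t) ∈ H) :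
    Ad (expU x) ∈ H :=
  hH.mem_of_tendsto ((continuous_Ad.tendsto _).comp (tendsto_pow_of_hasDerivAt h0 hγ))
    (Eventually.of_forall fun n => by
      simp only [Function.comp_apply, map_pow]
      exact H.pow_mem (hmem _) _)

/-- The space `L(H)` of infinitesimal generators of a closed group `H` of automorphisms: the complex
span of the self-adjoint `x` with `Ad (exp (i t x)) ∈ H` for all real `t`. -/
def lieSubmodule (H : Subgroup (A ≃⋆ₐ[ℂ] A)) (hH : IsClosed (H : Set (A ≃⋆ₐ[ℂ] A))) :
    Submodule ℂ A where
  carrier := {z | ∀ c : ℂ, Ad (expU (c • z)) ∈ H}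
  zero_mem' c := by simp [H.one_mem]
  smul_mem' d z hz c := by
    rw [smul_smul]
    exact hz _
  add_mem' {z w} hz hw c := by
    refine Ad_expU_mem_of_hasDerivAt hH
      (γ := fun t => expU (t • (c • z)) * expU (t • (c • w))) (by simp) ?_ fun t => ?_
    · have := (hasDerivAt_expU_zero (c • z)).mul (hasDerivAt_expU_zero (c • w))
      simp only [zero_smul, expU_zero, OneMemClass.coe_one, mul_one, one_mul] at this
      rw [smul_add, map_add, AddSubgroup.coe_add, smul_add]
      exact this
    · rw [map_mul]
      refine H.mul_mem ?_ ?_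
      · rw [← Complex.coe_smul, smul_smul]
        exact hz _
      · rw [← Complex.coe_smul, smul_smul]
        exact hw _

section Lie

variable {H : Subgroup (A ≃⋆ₐ[ℂ] A)} {hH : IsClosed (H : Set (A ≃⋆ₐ[ℂ] A))}

theorem mem_lieSubmodule {z : A} : z ∈ lieSubmodule H hH ↔ ∀ c : ℂ, Ad (expU (c • z)) ∈ H :=
  Iff.rfl

theorem Ad_expU_mem {z : A} (hz : z ∈ lieSubmodule H hH) : Ad (expU z) ∈ H := by
  simpa using hz 1

theorem isClosed_lieSubmodule : IsClosed (lieSubmodule H hH : Set A) := by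
  have : (lieSubmodule H hH : Set A) = ⋂ c : ℂ, (fun z => Ad (expU (c • z))) ⁻¹' (H : Set _) := by
    ext z
    simp [mem_lieSubmodule]
  rw [this]
  exact isClosed_iInter fun c => hH.preimage
    (continuous_Ad.comp (continuous_expU.comp (continuous_const_smul c)))

theorem realPart_mem_lieSubmodule {z : A} (hz : z ∈ lieSubmodule H hH) :
    (realPart z : A) ∈ lieSubmodule H hH := fun c => by
  have e : expU (c • (realPart z : A)) = expU (((c.re : ℝ) : ℂ) • z) := by
    rw [← expU_realPart, ← expU_realPart (((c.re : ℝ) : ℂ) • z)]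
    congr 2
    rw [realPart_smul, realPart_smul]
    simp
  rw [e]
  exact hz _

theorem map_expU (φ : A ≃⋆ₐ[ℂ] A) (x : A) : φ (expU x : A) = expU (φ x) := by
  let +nondep : NormedAlgebra ℚ A := .restrictScalars ℚ ℂ A
  have hφ : Continuous φ := (StarAlgEquiv.isometry φ).continuous
  rw [coe_expU, coe_expU, NormedSpace.map_exp φ hφ, map_smul]
  congr 2
  rw [realPart_apply_coe, realPart_apply_coe, ← Complex.coe_smul, ← Complex.coe_smul, map_smul,
    map_add, map_star]

theorem conj_Ad_expU (φ : A ≃⋆ₐ[ℂ] A) (x : A) : φ * Ad (expU x) * φ⁻¹ = Ad (expU (φ x)) := by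
  ext a
  change φ ((expU x : A) * φ⁻¹ a * star (expU x : A)) = expU (φ x) * a * star (expU (φ x) : A)
  rw [map_mul, map_mul, map_star, map_expU]
  congr 2
  exact φ.apply_symm_apply a

/-- If `H` absorbs the commutators of `φ` with all inner automorphisms `Ad (exp (i t x))`, then
`φ z - z` is an infinitesimal generator of `H`. -/
theorem map_sub_mem_lieSubmodule {φ : A ≃⋆ₐ[ℂ] A} {z : A}
    (h : ∀ c : ℂ, φ * Ad (expU (c • z)) * φ⁻¹ * (Ad (expU (c • z)))⁻¹ ∈ H) :
    φ z - z ∈ lieSubmodule H hH := fun c => by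
  refine Ad_expU_mem_of_hasDerivAt hH
    (γ := fun t => expU (t • (φ (c • z))) * expU (t • (-(c • z)))) (by simp) ?_ fun t => ?_
  · have := (hasDerivAt_expU_zero (φ (c • z))).mul (hasDerivAt_expU_zero (-(c • z)))
    simp only [zero_smul, expU_zero, OneMemClass.coe_one, mul_one, one_mul] at this
    rw [smul_sub, ← map_smul, sub_eq_add_neg, map_add, AddSubgroup.coe_add, smul_add]
    exact this
  · have := h ((t : ℂ) * c)
    rw [conj_Ad_expU, ← map_inv, ← expU_neg, ← map_mul] at this
    rw [← Complex.coe_smul, ← Complex.coe_smul, smul_neg, ← map_smul, smul_smul]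
    exact this

theorem map_mem_lieSubmodule {φ : A ≃⋆ₐ[ℂ] A} (hφ : ∀ ψ ∈ H, φ * ψ * φ⁻¹ ∈ H) {z : A}
    (hz : z ∈ lieSubmodule H hH) : φ z ∈ lieSubmodule H hH := fun c => by
  rw [← map_smul, ← conj_Ad_expU]
  exact hφ _ (hz c)

/-- If a closed subspace contains `Ad (exp (i t Re (c x))) y - y` for all `t` and `c`, it contains
the derivatives, and hence the commutator `[x, y]`. -/
theorem commutator_mem_of_Ad_sub_mem {M : Submodule ℂ A} (hM : IsClosed (M : Set A)) {x y : A}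
    (h : ∀ c : ℂ, Ad (expU (c • x)) y - y ∈ M) : x * y - y * x ∈ M := by
  have key : ∀ c : ℂ, (realPart (c • x) : A) * y - y * (realPart (c • x) : A) ∈ M := by
    intro c
    have hd := ((hasDerivAt_expU_zero (c • x)).mul_const y).fun_mul
      (hasDerivAt_expU_zero (-(c • x)))
    simp only [zero_smul, expU_zero, OneMemClass.coe_one, mul_one, one_mul, map_neg,
      AddSubgroup.coe_neg, smul_neg, mul_neg, neg_zero] at hd
    have h1 := (hasDerivAt_iff_tendsto_slope_zero.1 hd)
    have h2 : I • (realPart (c • x) : A) * y + -(y * I • (realPart (c • x) : A)) ∈ M := by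
      refine hM.mem_of_tendsto h1 (Eventually.of_forall fun t => ?_)
      rw [← Complex.coe_smul]
      refine M.smul_mem _ ?_
      have := h ((t : ℂ) * c)
      rw [mul_smul, Complex.coe_smul, Unitary.conjStarAlgAut_apply, ← Unitary.coe_star,
        Unitary.star_eq_inv, ← expU_neg] at this
      simpa using this
    have h3 := M.smul_mem (-I) h2
    have e : -I • (I • (realPart (c • x) : A) * y + -(y * I • (realPart (c • x) : A)))
        = (realPart (c • x) : A) * y - y * (realPart (c • x) : A) := by
      rw [← sub_eq_add_neg, smul_mul_assoc, mul_smul_comm, ← smul_sub, smul_smul]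
      simp
    rwa [e] at h3
  have h1 := key 1
  have h2 := M.smul_mem I (key (-I))
  have e : x * y - y * x = ((realPart ((1 : ℂ) • x) : A) * y - y * (realPart ((1 : ℂ) • x) : A))
      + I • ((realPart (-I • x) : A) * y - y * (realPart (-I • x) : A)) := by
    have e1 : (realPart (-I • x) : A) = imaginaryPart x := by
      rw [realPart_smul]
      simp
    rw [e1, one_smul]
    conv_lhs => rw [← realPart_add_I_smul_imaginaryPart x]
    simp only [add_mul, mul_add, smul_sub, smul_mul_assoc, mul_smul_comm]
    abel
  rw [e]
  exact M.add_mem h1 h2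

end Lie

/-- `Ad (exp (i h))` and `Ad (exp (i k))` are close at `a` if the derivations given by `h` and `k`
are close on the orbit of `a` under the first of the two one-parameter groups; no bound on `k` is
needed. -/
theorem dist_Ad_expU_le {h k : A} (hh : IsSelfAdjoint h) (hk : IsSelfAdjoint k) (a : A) {ε : ℝ}
    (hε : ∀ t ∈ Set.Icc (0 : ℝ) 1,
      ‖(h - k) * Ad (expU (t • h)) a - Ad (expU (t • h)) a * (h - k)‖ ≤ ε) :
    dist (Ad (expU k) a) (Ad (expU h) a) ≤ ε := by
  -- the curve `Ad (exp (-i t k)) (Ad (exp (i t h)) a)` has a derivative of norm at most `ε`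
  let F : ℝ → A := fun t =>
    (expU (t • (-k)) : A) * ((expU (t • h) : A) * a * (expU (t • (-h)) : A)) * (expU (t • k) : A)
  have hB : ∀ t : ℝ, (expU (t • h) : A) * a * (expU (t • (-h)) : A) = Ad (expU (t • h)) a := by
    intro t
    rw [smul_neg, coe_expU_neg, Unitary.conjStarAlgAut_apply]
  have hF : ∀ t, HasDerivAt F ((expU (t • (-k)) : A) * (I • ((h - k) * Ad (expU (t • h)) a
      - Ad (expU (t • h)) a * (h - k))) * (expU (t • k) : A)) t := by
    intro t
    have := ((hasDerivAt_expU (-k) t).fun_mul (((hasDerivAt_expU' h t).mul_const a).fun_mul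
      (hasDerivAt_expU (-h) t))).fun_mul (hasDerivAt_expU' k t)
    refine this.congr_deriv ?_
    rw [← hB]
    simp only [map_neg, AddSubgroup.coe_neg, hh.coe_realPart, hk.coe_realPart, smul_neg,
      smul_sub, mul_sub, sub_mul, smul_mul_assoc, mul_smul_comm, mul_neg, neg_mul, mul_add, add_mul,
      mul_assoc]
    abel
  have hle := norm_image_sub_le_of_norm_deriv_le_segment_01' (f := F) (C := ε)
    (fun t _ => (hF t).hasDerivWithinAt) (fun t ht => by
      rw [CStarRing.norm_mul_coe_unitary, CStarRing.norm_coe_unitary_mul, norm_smul, norm_I,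
        one_mul]
      exact hε t ⟨ht.1, ht.2.le⟩)
  have h1 : F 1 - F 0 = (expU (-k) : A) * (Ad (expU h) a - Ad (expU k) a) * (expU k : A) := by
    have e1 := hB 1
    have e2 : (expU (-k) : A) * (expU k : A) = 1 := by rw [coe_expU_neg]; simp
    simp only [F, e1]
    simp only [one_smul, zero_smul, expU_zero, OneMemClass.coe_one, one_mul, mul_one, mul_sub,
      sub_mul]
    congr 1
    rw [Unitary.conjStarAlgAut_apply, ← coe_expU_neg]
    calc a = 1 * a * 1 := by simp
      _ = ((expU (-k) : A) * expU k) * a * ((expU (-k) : A) * expU k) := by rw [e2]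
      _ = _ := by noncomm_ring
  rw [h1, CStarRing.norm_mul_coe_unitary, CStarRing.norm_coe_unitary_mul] at hle
  rwa [dist_comm, dist_eq_norm]

theorem mem_of_forall_finset_close {H : Subgroup (A ≃⋆ₐ[ℂ] A)}
    (hH : IsClosed (H : Set (A ≃⋆ₐ[ℂ] A))) {φ : A ≃⋆ₐ[ℂ] A}
    (h : ∀ (F : Finset A) (ε : ℝ), 0 < ε → ∃ ψ ∈ H, ∀ a ∈ F, dist (ψ a) (φ a) ≤ ε) : φ ∈ H := by
  classical
  choose ψ hψH hψ using fun p : Finset A × ℕ =>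
    h p.1 _ (Nat.one_div_pos_of_nat (α := ℝ) (n := p.2))
  have hlim : Tendsto ψ atTop (𝓝 φ) := by
    rw [nhds_induced, tendsto_comap_iff, tendsto_pi_nhds]
    intro a
    rw [Metric.tendsto_nhds]
    intro ρ hρ
    obtain ⟨n, hn⟩ := exists_nat_one_div_lt hρ
    filter_upwards [eventually_ge_atTop (({a} : Finset A), n)] with p hp
    exact (hψ p a (hp.1 (by simp))).trans_lt ((Nat.one_div_le_one_div hp.2).trans_lt hn)
  exact hH.mem_of_tendsto hlim (Eventually.of_forall hψH)

/-- If the commutators `star x * x - x * star x` with `x` in the closed ideal `J` are infinitesimal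
generators of the closed group `H`, then so are all elements of `J`. That `H` is closed for
pointwise convergence is essential: an element of `J` need not be a limit of sums of commutators and
central elements, but the derivation it induces is a pointwise limit of derivations induced by sums
of commutators. -/
theorem mem_lieSubmodule_of_mem_ideal {J : TwoSidedIdeal A} (hJ : IsClosed (J : Set A))
    {H : Subgroup (A ≃⋆ₐ[ℂ] A)} {hH : IsClosed (H : Set (A ≃⋆ₐ[ℂ] A))}
    (h : ∀ x ∈ J, star x * x - x * star x ∈ lieSubmodule H hH) {z : A} (hz : z ∈ J) :
    z ∈ lieSubmodule H hH := by
  intro c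
  have hcz : (realPart (c • z) : A) ∈ J := realPart_mem_ideal hJ (smul_mem_ideal J c hz)
  rw [← expU_realPart]
  set w : A := (realPart (c • z) : A) with hw
  have hws : IsSelfAdjoint w := (realPart (c • z)).2
  refine mem_of_forall_finset_close hH fun F ε hε => ?_
  let α : C({a // a ∈ F} × unitInterval, A) :=
    ⟨fun p => Ad (expU ((p.2 : ℝ) • w)) p.1, by
      have h1 : Continuous fun p : {a // a ∈ F} × unitInterval => (expU ((p.2 : ℝ) • w) : A) :=
        continuous_subtype_val.comp (continuous_expU.comp (by fun_prop))
      have h2 : Continuous fun p : {a // a ∈ F} × unitInterval => (p.1 : A) := by fun_prop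
      simp only [Unitary.conjStarAlgAut_apply]
      exact (h1.mul h2).mul h1.star⟩
  obtain ⟨k, hk, hkα⟩ := exists_commutatorFamily_close hJ
    (W := (lieSubmodule H hH).restrictScalars ℝ ⊓ selfAdjoint.submodule ℝ A)
    (fun x hx => ⟨h x hx, (IsSelfAdjoint.star_mul_self x).sub (IsSelfAdjoint.mul_star_self x)⟩)
    α hcz hws hε
  refine ⟨Ad (expU k), Ad_expU_mem (hH := hH) hk.1, fun a ha => ?_⟩
  exact dist_Ad_expU_le hws hk.2 a fun t ht => (hkα (⟨a, ha⟩, ⟨t, ht⟩)).le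

/-! ### The groups of approximately inner automorphisms -/

theorem Ad_mem_adClosure {G : Subgroup (unitary A)} {u : unitary A} (hu : u ∈ G) :
    Ad u ∈ adClosure G :=
  Subgroup.le_topologicalClosure _ (Subgroup.mem_map_of_mem _ hu)

theorem isClosed_adClosure (G : Subgroup (unitary A)) :
    IsClosed (adClosure G : Set (A ≃⋆ₐ[ℂ] A)) :=
  Subgroup.isClosed_topologicalClosure _

theorem isClosed_autV : IsClosed (autV A : Set (A ≃⋆ₐ[ℂ] A)) := isClosed_adClosure _

theorem isClosed_idealV (J : TwoSidedIdeal A) : IsClosed (idealV J : Set (A ≃⋆ₐ[ℂ] A)) :=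
  isClosed_adClosure _

/-- The elements of `adClosure G` satisfy every closed condition satisfied by the `Ad u`,
`u ∈ G`. -/
theorem adClosure_subset {G : Subgroup (unitary A)} {S : Set (A ≃⋆ₐ[ℂ] A)} (hS : IsClosed S)
    (h : ∀ u ∈ G, Ad u ∈ S) {φ : A ≃⋆ₐ[ℂ] A} (hφ : φ ∈ adClosure G) : φ ∈ S := by
  refine closure_minimal ?_ hS (show φ ∈ closure _ from hφ)
  rintro _ ⟨u, hu, rfl⟩
  exact h u hu

theorem connectedComponentOfOne_le {G : Type*} [Group G] [TopologicalSpace G]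
    [IsTopologicalGroup G] {N : Subgroup G} (hN : (N : Set G) ∈ 𝓝 1) :
    Subgroup.connectedComponentOfOne G ≤ N := by
  have ho : IsOpen (N : Set G) := N.isOpen_of_mem_nhds hN
  exact IsClopen.connectedComponent_subset ⟨N.isClosed_of_isOpen ho, ho⟩ N.one_mem

theorem autV_le {H : Subgroup (A ≃⋆ₐ[ℂ] A)} (hH : IsClosed (H : Set (A ≃⋆ₐ[ℂ] A)))
    (h : ∀ x : A, Ad (expU x) ∈ H) : autV A ≤ H := by
  refine fun φ hφ => adClosure_subset hH (fun u hu => ?_) hφ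
  have hN : ((H.comap (Ad : unitary A →* A ≃⋆ₐ[ℂ] A) : Subgroup (unitary A)) : Set (unitary A))
      ∈ 𝓝 1 := by
    refine Filter.mem_of_superset (Metric.ball_mem_nhds 1 (zero_lt_two' ℝ)) fun v hv => ?_
    rw [Metric.mem_ball, Subtype.dist_eq, dist_eq_norm] at hv
    have := h (Unitary.argSelfAdjoint v : A)
    rwa [expU_of_argSelfAdjoint hv] at this
  exact connectedComponentOfOne_le hN hu

theorem Ad_expU_mem_autV (x : A) : Ad (expU x) ∈ autV A :=
  Ad_mem_adClosure (pathComponent_subset_component _ (selfAdjoint.joined_one_expUnitary _))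

/-- Together with `mem_lieSubmodule_idealV`: for closed `H`, the group `V_J` is contained in `H` if
and only if the elements of `J` are infinitesimal generators of `H`. -/
theorem idealV_le {J : TwoSidedIdeal A} (hJ : IsClosed (J : Set A)) {H : Subgroup (A ≃⋆ₐ[ℂ] A)}
    (hH : IsClosed (H : Set (A ≃⋆ₐ[ℂ] A))) (h : ∀ z ∈ J, z ∈ lieSubmodule H hH) :
    idealV J ≤ H := by
  refine fun φ hφ => adClosure_subset hH ?_ hφ
  rintro _ ⟨u, hu, rfl⟩
  have hN : (((H.comap (Ad : unitary A →* A ≃⋆ₐ[ℂ] A)).comap (idealUnitary J).subtype :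
      Subgroup (idealUnitary J)) : Set (idealUnitary J)) ∈ 𝓝 1 := by
    refine Filter.mem_of_superset (Metric.ball_mem_nhds 1 (zero_lt_two' ℝ)) fun v hv => ?_
    rw [Metric.mem_ball, Subtype.dist_eq, Subtype.dist_eq, dist_eq_norm] at hv
    have := Ad_expU_mem (h _ (argSelfAdjoint_mem_ideal hJ v.2 hv))
    rwa [expU_of_argSelfAdjoint hv] at this
  exact connectedComponentOfOne_le hN hu

theorem expU_mem_idealUnitary {J : TwoSidedIdeal A} (hJ : IsClosed (J : Set A)) {x : A}
    (hx : x ∈ J) : expU x ∈ idealUnitary J := by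
  change (expU x : A) - 1 ∈ J
  rw [coe_expU]
  exact exp_sub_one_mem_ideal hJ (smul_mem_ideal J _ (realPart_mem_ideal hJ hx))

theorem mem_lieSubmodule_idealV {J : TwoSidedIdeal A} (hJ : IsClosed (J : Set A)) {z : A}
    (hz : z ∈ J) : z ∈ lieSubmodule (idealV J) (isClosed_idealV J) := by
  intro c
  have hcz : c • z ∈ J := smul_mem_ideal J c hz
  have hmem : ∀ t : unitInterval, expU ((t : ℝ) • (c • z)) ∈ idealUnitary J := fun t =>
    expU_mem_idealUnitary hJ (smul_mem_ideal J _ hcz)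
  let p : Path (1 : idealUnitary J) ⟨expU (c • z), expU_mem_idealUnitary hJ hcz⟩ :=
    { toFun := fun t => ⟨expU ((t : ℝ) • (c • z)), hmem t⟩
      continuous_toFun := (continuous_expU.comp (by fun_prop)).subtype_mk _
      source' := by ext; simp
      target' := by ext; simp }
  exact Ad_mem_adClosure ⟨⟨expU (c • z), expU_mem_idealUnitary hJ hcz⟩,
    pathComponent_subset_component _ ⟨p⟩, rfl⟩

theorem idealV_mono {I J : TwoSidedIdeal A} (hI : IsClosed (I : Set A)) (hJ : IsClosed (J : Set A))
    (h : I ≤ J) : idealV I ≤ idealV J :=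
  idealV_le hI (isClosed_idealV J) fun _ hz => mem_lieSubmodule_idealV hJ (h hz)

theorem idealV_le_autV {J : TwoSidedIdeal A} (hJ : IsClosed (J : Set A)) : idealV J ≤ autV A :=
  idealV_le hJ isClosed_autV fun _ _ _ => Ad_expU_mem_autV _

/-- The automorphisms in `V_A` preserve all closed ideals. -/
theorem map_mem_ideal_of_mem_autV {J : TwoSidedIdeal A} (hJ : IsClosed (J : Set A))
    {φ : A ≃⋆ₐ[ℂ] A} (hφ : φ ∈ autV A) {z : A} (hz : z ∈ J) : φ z ∈ J := by
  refine adClosure_subset (S := {φ | φ z ∈ J}) (hJ.preimage (continuous_aut_apply z))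
    (fun u _ => ?_) hφ
  exact J.mul_mem_right _ _ (J.mul_mem_left _ _ hz)

/-- The automorphisms in `V_J` are trivial modulo `J`. -/
theorem map_sub_mem_ideal_of_mem_idealV {J : TwoSidedIdeal A} (hJ : IsClosed (J : Set A))
    {φ : A ≃⋆ₐ[ℂ] A} (hφ : φ ∈ idealV J) (a : A) : φ a - a ∈ J := by
  refine adClosure_subset (S := {φ | φ a - a ∈ J})
    (hJ.preimage ((continuous_aut_apply a).sub continuous_const)) ?_ hφ
  rintro _ ⟨u, -, rfl⟩
  have hu : ((u : unitary A) : A) - 1 ∈ J := u.2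
  have e : ((u : unitary A) : A) * a * star ((u : unitary A) : A) - a
      = ((((u : unitary A) : A) - 1) * a - a * (((u : unitary A) : A) - 1)) *
        star ((u : unitary A) : A) := by
    have := Unitary.mul_star_self_of_mem (u : unitary A).2
    calc _ = ((u : unitary A) : A) * a * star ((u : unitary A) : A)
          - a * (((u : unitary A) : A) * star ((u : unitary A) : A)) := by rw [this, mul_one]
      _ = _ := by noncomm_ring
  change ((u : unitary A) : A) * a * star ((u : unitary A) : A) - a ∈ J
  rw [e]
  exact J.mul_mem_right _ _ (J.sub_mem (J.mul_mem_right _ _ hu) (J.mul_mem_left _ _ hu))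

theorem conj_mem_idealV {J : TwoSidedIdeal A} (hJ : IsClosed (J : Set A)) {φ ψ : A ≃⋆ₐ[ℂ] A}
    (hφ : φ ∈ autV A) (hψ : ψ ∈ idealV J) : φ * ψ * φ⁻¹ ∈ idealV J := by
  have hc : IsClosed (((idealV J).comap (MulAut.conj φ).toMonoidHom : Subgroup (A ≃⋆ₐ[ℂ] A)) :
      Set (A ≃⋆ₐ[ℂ] A)) :=
    (isClosed_idealV J).preimage (f := fun ψ => φ * ψ * φ⁻¹) (by fun_prop)
  refine idealV_le hJ hc (fun z hz c => ?_) hψ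
  change φ * Ad (expU (c • z)) * φ⁻¹ ∈ idealV J
  rw [conj_Ad_expU, map_smul]
  exact mem_lieSubmodule_idealV hJ (map_mem_ideal_of_mem_autV hJ hφ hz) c

/-- The group `V_J` is topologically perfect, for every closed ideal `J`: the derivatives of
commutators of `V_J` show that the commutators of `J` are infinitesimal generators of
`closure (V_J, V_J)`, hence so are all elements of `J`. -/
theorem isTopologicallyPerfect_idealV {J : TwoSidedIdeal A} (hJ : IsClosed (J : Set A)) :
    IsTopologicallyPerfect (idealV J) := by
  have hc : IsClosed ((⁅idealV J, idealV J⁆.topologicalClosure : Subgroup (A ≃⋆ₐ[ℂ] A)) :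
    Set (A ≃⋆ₐ[ℂ] A)) := Subgroup.isClosed_topologicalClosure _
  refine le_antisymm (Subgroup.topologicalClosure_minimal _ (Subgroup.commutator_le_self _)
    (isClosed_idealV J)) (idealV_le hJ hc fun z hz => mem_lieSubmodule_of_mem_ideal hJ ?_ hz)
  intro x hx
  refine commutator_mem_of_Ad_sub_mem isClosed_lieSubmodule fun c =>
    map_sub_mem_lieSubmodule fun d => Subgroup.le_topologicalClosure _ ?_
  exact Subgroup.commutator_mem_commutator
    (mem_lieSubmodule_idealV hJ (star_mem_ideal hJ hx) c) (mem_lieSubmodule_idealV hJ hx d)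

/-- The derivatives of the automorphisms in `V_I = V_J`, which are trivial modulo `J`, show that
`[I, I] ⊆ J`. -/
theorem le_of_idealV_eq {I J : TwoSidedIdeal A} (hI : IsPerfectIdeal I) (hJ : IsClosed (J : Set A))
    (h : idealV I = idealV J) : I ≤ J := by
  rw [hI.eq_closedIdeal]
  refine closedIdeal_commutatorSpan_le hJ fun x hx y _ => ?_
  let M : Submodule ℂ A :=
    { carrier := J
      add_mem' := J.add_mem
      zero_mem' := J.zero_mem
      smul_mem' := fun c _ h => smul_mem_ideal J c h }
  refine commutator_mem_of_Ad_sub_mem (M := M) hJ fun c => ?_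
  exact map_sub_mem_ideal_of_mem_idealV hJ (h ▸ mem_lieSubmodule_idealV hI.isClosed hx c) y

/-! ### Closed normal subgroups -/

/-- For a closed Lie ideal `L`, the closed ideal `J` generated by `[L, L]` satisfies `[J, A] ⊆ L`
(Herstein). The elements `t` with `[t, A] ⊆ L` form an algebra `T ⊇ L`, and for `x y ∈ L` the
identities `[x, y] * b = [x, y * b] - y * [x, b]` and `a * t = [a, t] + t * a` show that `T`
contains the ideal generated by `[x, y]`. -/
theorem commutator_mem_of_mem_closedIdeal {L : Submodule ℂ A} (hL : IsClosed (L : Set A))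
    (hLie : ∀ x ∈ L, ∀ a, x * a - a * x ∈ L) {t : A}
    (ht : t ∈ closedIdeal {z | ∃ x ∈ L, ∃ y ∈ L, z = x * y - y * x}) (a : A) :
    t * a - a * t ∈ L := by
  let T : Set A := {t | ∀ a, t * a - a * t ∈ L}
  have hTadd : ∀ t ∈ T, ∀ s ∈ T, t + s ∈ T := fun t ht s hs a => by
    have e : (t + s) * a - a * (t + s) = (t * a - a * t) + (s * a - a * s) := by noncomm_ring
    rw [e]; exact L.add_mem (ht a) (hs a)
  have hTneg : ∀ t ∈ T, -t ∈ T := fun t ht a => by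
    have e : -t * a - a * -t = -(t * a - a * t) := by noncomm_ring
    rw [e]; exact L.neg_mem (ht a)
  have hTmul : ∀ t ∈ T, ∀ s ∈ T, t * s ∈ T := fun t ht s hs a => by
    have e : t * s * a - a * (t * s) = (t * (s * a) - s * a * t) + (s * (a * t) - a * t * s) := by
      noncomm_ring
    rw [e]; exact L.add_mem (ht _) (hs _)
  have hTL : ∀ x ∈ L, x ∈ T := hLie
  have hTclosed : IsClosed T := by
    have : T = ⋂ a, (fun t => t * a - a * t) ⁻¹' (L : Set A) := by
      ext t
      simp [T]
    rw [this]
    exact isClosed_iInter fun a => hL.preimage (by fun_prop)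
  let I : TwoSidedIdeal A := TwoSidedIdeal.mk' {t | ∀ a b, a * t * b ∈ T}
    (fun a b c => by simp [L.zero_mem])
    (fun {t s} ht hs a b => by
      rw [mul_add, add_mul]; exact hTadd _ (ht a b) _ (hs a b))
    (fun {t} ht a b => by
      rw [mul_neg, neg_mul]; exact hTneg _ (ht a b))
    (fun {c t} ht a b => by rw [← mul_assoc]; exact ht _ _)
    (fun {t c} ht a b => by rw [← mul_assoc, mul_assoc]; exact ht _ _)
  have hI : ∀ t, t ∈ I ↔ ∀ a b, a * t * b ∈ T := fun t => TwoSidedIdeal.mem_mk' _ _ _ _ _ _ t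
  have hIc : IsClosed (I : Set A) := by
    have : (I : Set A) = ⋂ (a) (b), (fun t => a * t * b) ⁻¹' T := by
      ext t
      simp only [SetLike.mem_coe, hI, Set.mem_iInter, Set.mem_preimage]
    rw [this]
    exact isClosed_iInter fun a => isClosed_iInter fun b => hTclosed.preimage (by fun_prop)
  have hle : closedIdeal {z | ∃ x ∈ L, ∃ y ∈ L, z = x * y - y * x} ≤ I := by
    refine closedIdeal_le hIc ?_
    rintro _ ⟨x, hx, y, hy, rfl⟩
    rw [SetLike.mem_coe, hI]
    have hright : ∀ b, (x * y - y * x) * b ∈ T := fun b => by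
      have e : (x * y - y * x) * b = (x * (y * b) - y * b * x) + -(y * (x * b - b * x)) := by
        noncomm_ring
      rw [e]
      exact hTadd _ (hTL _ (hLie x hx _)) _
        (hTneg _ (hTmul _ (hTL y hy) _ (hTL _ (hLie x hx b))))
    intro a b
    have e : a * (x * y - y * x) * b
        = -((x * y - y * x) * b * a - a * ((x * y - y * x) * b)) + (x * y - y * x) * (b * a) := by
      noncomm_ring
    rw [e]
    exact hTadd _ (hTneg _ (hTL _ (hright b a))) _ (hright _)
  have := (hI t).1 (hle ht) 1 1 a
  simpa using this

/-- If `N` is closed and normalized by `Ad (exp (i t Re x))`, then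
`Ad (exp (i Re (x + m))) * Ad (exp (i Re x))⁻¹` belongs to `N` for every infinitesimal generator `m`
of `N`: modulo `N`, both exponentials are limits of the same products in the Lie–Trotter formula. -/
theorem Ad_expU_add_mul_inv_mem {N : Subgroup (A ≃⋆ₐ[ℂ] A)}
    {hN : IsClosed (N : Set (A ≃⋆ₐ[ℂ] A))} {x m : A} (hm : m ∈ lieSubmodule N hN)
    (hx : ∀ t : ℝ, ∀ ψ ∈ N, Ad (expU (t • x)) * ψ * (Ad (expU (t • x)))⁻¹ ∈ N) :
    Ad (expU (x + m)) * (Ad (expU x))⁻¹ ∈ N := by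
  have hpow : ∀ (n : ℕ) (α β : A ≃⋆ₐ[ℂ] A), (∀ ψ ∈ N, α * ψ * α⁻¹ ∈ N) → β ∈ N →
      (α * β) ^ n * (α ^ n)⁻¹ ∈ N := by
    intro n α β hα hβ
    induction n with
    | zero => simp [N.one_mem]
    | succ n ih =>
      have e : (α * β) ^ (n + 1) * (α ^ (n + 1))⁻¹
          = α * (β * ((α * β) ^ n * (α ^ n)⁻¹)) * α⁻¹ := by
        rw [pow_succ' (α * β), pow_succ' α, mul_inv_rev]
        simp only [mul_assoc]
      rw [e]
      exact hα _ (N.mul_mem hβ ih)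
  have hγ : HasDerivAt (fun t : ℝ => ((expU (t • x) * expU (t • m) : unitary A) : A))
      (I • (realPart (x + m) : A)) 0 := by
    have := (hasDerivAt_expU_zero x).fun_mul (hasDerivAt_expU_zero m)
    simp only [zero_smul, expU_zero, OneMemClass.coe_one, mul_one, one_mul] at this
    rw [map_add, AddSubgroup.coe_add, smul_add]
    exact this
  have hlim := tendsto_pow_of_hasDerivAt (γ := fun t => expU (t • x) * expU (t • m)) (by simp) hγ
  refine hN.mem_of_tendsto (((continuous_Ad.tendsto _).comp hlim).mul_const _)
    (Eventually.of_forall fun n => ?_)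
  simp only [Function.comp_apply]
  rw [expU_eq_pow n x]
  simp only [map_pow, map_mul]
  refine hpow _ _ _ (hx _) ?_
  have := hm ((1 / ((n : ℝ) + 1) : ℝ) : ℂ)
  rwa [Complex.coe_smul] at this

/-- The elements of `P` that commute with every element of `S` modulo `N`, where `N` is normalized
by `P`. -/
def relativeCentralizer {G : Type*} [Group G] (P N : Subgroup G)
    (hN : ∀ p ∈ P, ∀ n ∈ N, p * n * p⁻¹ ∈ N) (S : Set G) : Subgroup G where
  carrier := {w | w ∈ P ∧ ∀ φ ∈ S, φ * w * φ⁻¹ * w⁻¹ ∈ N}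
  one_mem' := ⟨P.one_mem, fun φ _ => by simp [N.one_mem]⟩
  mul_mem' := by
    rintro v w ⟨hv, hv'⟩ ⟨hw, hw'⟩
    refine ⟨P.mul_mem hv hw, fun φ hφ => ?_⟩
    have e : φ * (v * w) * φ⁻¹ * (v * w)⁻¹
        = (φ * v * φ⁻¹ * v⁻¹) * (v * (φ * w * φ⁻¹ * w⁻¹) * v⁻¹) := by group
    rw [e]
    exact N.mul_mem (hv' φ hφ) (hN v hv _ (hw' φ hφ))
  inv_mem' := by
    rintro w ⟨hw, hw'⟩
    refine ⟨P.inv_mem hw, fun φ hφ => ?_⟩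
    have e : φ * w⁻¹ * φ⁻¹ * w⁻¹⁻¹ = w⁻¹ * (φ * w * φ⁻¹ * w⁻¹)⁻¹ * w⁻¹⁻¹ := by group
    rw [e]
    exact hN _ (P.inv_mem hw) _ (N.inv_mem (hw' φ hφ))

theorem isClosed_relativeCentralizer {G : Type*} [Group G] [TopologicalSpace G]
    [IsTopologicalGroup G] {P N : Subgroup G} (hN : ∀ p ∈ P, ∀ n ∈ N, p * n * p⁻¹ ∈ N) (S : Set G)
    (hP : IsClosed (P : Set G)) (hNc : IsClosed (N : Set G)) :
    IsClosed (relativeCentralizer P N hN S : Set G) := by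
  have : (relativeCentralizer P N hN S : Set G)
      = (P : Set G) ∩ ⋂ φ ∈ S, (fun w => φ * w * φ⁻¹ * w⁻¹) ⁻¹' (N : Set G) := by
    ext w
    simp only [Set.mem_inter_iff, Set.mem_iInter, Set.mem_preimage]
    rfl
  rw [this]
  exact hP.inter (isClosed_biInter fun φ _ => hNc.preimage (by fun_prop))

/-- A closed, normal, topologically perfect subgroup `H` of `V_A` is `V_J`, with `J` the closed
ideal generated by `[L, L]`, where `L` is the Lie ideal of infinitesimal generators of `H`. Let `N` be
the closed subgroup generated by the `Ad (exp (i Re z))`, `z ∈ L`. The commutators of `H` with `V_A` lie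
in `N`, so `H ≤ N` as `H` is topologically perfect; those of `N` with itself lie in `V_J`, so
`H ≤ V_J` for the same reason. Conversely `[J, A] ⊆ L` gives `V_J ≤ H`. -/
theorem exists_idealV_eq {H : Subgroup (A ≃⋆ₐ[ℂ] A)} (hHV : H ≤ autV A)
    (hH : IsClosed (H : Set (A ≃⋆ₐ[ℂ] A))) (hnormal : ∀ v ∈ autV A, ∀ ψ ∈ H, v * ψ * v⁻¹ ∈ H)
    (hperf : IsTopologicallyPerfect H) :
    ∃ J : TwoSidedIdeal A, IsClosed (J : Set A) ∧ idealV J = H := by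
  set L := lieSubmodule H hH with hLdef
  have hLc : IsClosed (L : Set A) := isClosed_lieSubmodule
  have hLinv : ∀ v ∈ autV A, ∀ z ∈ L, v z ∈ L := fun v hv z hz =>
    map_mem_lieSubmodule (hnormal v hv) hz
  have hLie' : ∀ z ∈ L, ∀ a, a * z - z * a ∈ L := fun z hz a =>
    commutator_mem_of_Ad_sub_mem hLc fun c => L.sub_mem (hLinv _ (Ad_expU_mem_autV _) z hz) hz
  have hLie : ∀ z ∈ L, ∀ a, z * a - a * z ∈ L := fun z hz a => by
    rw [← neg_sub]; exact L.neg_mem (hLie' z hz a)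
  set J := closedIdeal {z | ∃ x ∈ L, ∃ y ∈ L, z = x * y - y * x} with hJdef
  have hJc : IsClosed (J : Set A) := isClosed_closedIdeal _
  refine ⟨J, hJc, le_antisymm ?_ ?_⟩
  · refine idealV_le hJc hH fun z hz => mem_lieSubmodule_of_mem_ideal hJc (fun x hx => ?_) hz
    exact commutator_mem_of_mem_closedIdeal hLc hLie (star_mem_ideal hJc hx) x
  let E : Set (A ≃⋆ₐ[ℂ] A) := (fun z : A => Ad (expU z)) '' L
  let N : Subgroup (A ≃⋆ₐ[ℂ] A) := (Subgroup.closure E).topologicalClosure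
  have hNc : IsClosed (N : Set (A ≃⋆ₐ[ℂ] A)) := Subgroup.isClosed_topologicalClosure _
  have hNle : ∀ {Q : Subgroup (A ≃⋆ₐ[ℂ] A)}, IsClosed (Q : Set (A ≃⋆ₐ[ℂ] A)) →
      (∀ z ∈ L, Ad (expU z) ∈ Q) → N ≤ Q := fun {Q} hQ h =>
    Subgroup.topologicalClosure_minimal _ ((Subgroup.closure_le _).2 (by
      rintro _ ⟨z, hz, rfl⟩; exact h z hz)) hQ
  have hEN : ∀ z ∈ L, Ad (expU z) ∈ N := fun z hz =>
    Subgroup.le_topologicalClosure _ (Subgroup.subset_closure ⟨z, hz, rfl⟩)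
  have hLN : ∀ z ∈ L, z ∈ lieSubmodule N hNc := fun z hz c => hEN _ (L.smul_mem c hz)
  have hNV : N ≤ autV A := hNle isClosed_autV fun z _ => Ad_expU_mem_autV z
  have hNnormal : ∀ v ∈ autV A, ∀ ψ ∈ N, v * ψ * v⁻¹ ∈ N := by
    intro v hv ψ hψ
    have hc : IsClosed ((N.comap (MulAut.conj v).toMonoidHom : Subgroup (A ≃⋆ₐ[ℂ] A)) :
        Set (A ≃⋆ₐ[ℂ] A)) :=
      hNc.preimage (f := fun ψ => v * ψ * v⁻¹) (by fun_prop)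
    refine hNle hc (fun z hz => ?_) hψ
    change v * Ad (expU z) * v⁻¹ ∈ N
    rw [conj_Ad_expU]
    exact hEN _ (hLinv v hv z hz)
  -- the commutators of `H` with `V_A` lie in `N`
  have hHN : ∀ φ ∈ H, ∀ w ∈ autV A, φ * w * φ⁻¹ * w⁻¹ ∈ N := by
    intro φ hφ w hw
    refine (autV_le (isClosed_relativeCentralizer hNnormal (H : Set _) isClosed_autV hNc)
      (fun x => ⟨Ad_expU_mem_autV x, fun φ hφ => ?_⟩) hw).2 φ hφ
    have hm : φ x - x ∈ L := map_sub_mem_lieSubmodule fun c => by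
      have h1 := H.mul_mem hφ (hnormal _ (Ad_expU_mem_autV (c • x)) _ (H.inv_mem hφ))
      rwa [← mul_assoc, ← mul_assoc] at h1
    have := Ad_expU_add_mul_inv_mem (hLN _ hm) (fun t => hNnormal _ (Ad_expU_mem_autV (t • x)))
    rwa [add_sub_cancel, ← conj_Ad_expU] at this
  -- the commutators of `N` with itself lie in `V_J`
  have hVn : ∀ v ∈ autV A, ∀ ψ ∈ idealV J, v * ψ * v⁻¹ ∈ idealV J := fun v hv ψ hψ =>
    conj_mem_idealV hJc hv hψ
  have hEE : ∀ x ∈ L, ∀ y ∈ L,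
      Ad (expU x) * Ad (expU y) * (Ad (expU x))⁻¹ * (Ad (expU y))⁻¹ ∈ idealV J := by
    intro x hx y hy
    have hm : Ad (expU x) y - y ∈ J := by
      let B : Subalgebra ℂ A :=
        { carrier := {s | s * y - y * s ∈ J}
          add_mem' := fun {s t} hs ht => by
            have e : (s + t) * y - y * (s + t) = (s * y - y * s) + (t * y - y * t) := by
              noncomm_ring
            change (s + t) * y - y * (s + t) ∈ J
            rw [e]; exact J.add_mem hs ht
          mul_mem' := fun {s t} hs ht => by
            have e : s * t * y - y * (s * t) = s * (t * y - y * t) + (s * y - y * s) * t := by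
              noncomm_ring
            change s * t * y - y * (s * t) ∈ J
            rw [e]; exact J.add_mem (J.mul_mem_left _ _ ht) (J.mul_mem_right _ _ hs)
          algebraMap_mem' := fun c => by
            change algebraMap ℂ A c * y - y * algebraMap ℂ A c ∈ J
            rw [Algebra.commutes, sub_self]
            exact J.zero_mem }
      have hBc : IsClosed (B : Set A) :=
        hJc.preimage (f := fun s => s * y - y * s) (by fun_prop)
      have hxB : I • (realPart x : A) ∈ B := B.smul_mem (subset_closedIdeal _
        ⟨_, realPart_mem_lieSubmodule hx, y, hy, rfl⟩) I
      have hexp : (expU x : A) ∈ B := by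
        let +nondep : NormedAlgebra ℚ A := .restrictScalars ℚ ℂ A
        exact NormedSpace.exp_mem (R := ℂ) hBc hxB
      have e : (expU x : A) * y * star (expU x : A) - y
          = ((expU x : A) * y - y * (expU x : A)) * star (expU x : A) := by
        rw [sub_mul, mul_assoc y, Unitary.mul_star_self_of_mem (expU x).2, mul_one]
      rw [Unitary.conjStarAlgAut_apply, e]
      exact J.mul_mem_right _ _ hexp
    have := Ad_expU_add_mul_inv_mem (mem_lieSubmodule_idealV hJc hm)
      (fun t => hVn _ (Ad_expU_mem_autV (t • y)))
    rwa [add_sub_cancel, ← conj_Ad_expU] at this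
  have hEN' : ∀ x ∈ L, ∀ w ∈ N, Ad (expU x) * w * (Ad (expU x))⁻¹ * w⁻¹ ∈ idealV J := by
    intro x hx w hw
    exact (hNle (isClosed_relativeCentralizer hVn E isClosed_autV (isClosed_idealV J))
      (fun y hy => ⟨Ad_expU_mem_autV y, by rintro _ ⟨x, hx, rfl⟩; exact hEE x hx y hy⟩) hw).2 _
      ⟨x, hx, rfl⟩
  have hNN : ∀ φ ∈ N, ∀ w ∈ N, φ * w * φ⁻¹ * w⁻¹ ∈ idealV J := by
    intro φ hφ w hw
    refine (hNle (isClosed_relativeCentralizer hVn (N : Set _) isClosed_autV (isClosed_idealV J))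
      (fun y hy => ⟨Ad_expU_mem_autV y, fun φ hφ => ?_⟩) hw).2 φ hφ
    have := (idealV J).inv_mem (hEN' y hy φ hφ)
    rwa [show (Ad (expU y) * φ * (Ad (expU y))⁻¹ * φ⁻¹)⁻¹ = φ * Ad (expU y) * φ⁻¹ * (Ad (expU y))⁻¹
      by group] at this
  have hle : H ≤ N := by
    rw [← hperf]
    exact Subgroup.topologicalClosure_minimal _
      (Subgroup.commutator_le.2 fun φ hφ w hw => hHN φ hφ w (hHV hw)) hNc
  rw [← hperf]
  exact Subgroup.topologicalClosure_minimal _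
    (Subgroup.commutator_le.2 fun φ hφ w hw => hNN φ (hle hφ) w (hle hw)) (isClosed_idealV J)

/-- Passing to the closed ideal generated by `[J, J]` does not change `V_J`. -/
theorem idealV_closedIdeal_commutatorSpan {J : TwoSidedIdeal A} (hJ : IsClosed (J : Set A)) :
    idealV (closedIdeal (commutatorSpan (J : Set A) (J : Set A) : Set A)) = idealV J := by
  refine le_antisymm
    (idealV_mono (isClosed_closedIdeal _) hJ (closedIdeal_commutatorSpan_le_self hJ))
    (idealV_le hJ (isClosed_idealV _) fun z hz =>
      mem_lieSubmodule_of_mem_ideal hJ (fun x hx => ?_) hz)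
  exact mem_lieSubmodule_idealV (isClosed_closedIdeal _)
    (commutator_mem_closedIdeal (star_mem_ideal hJ hx) hx)

end CStarNormal
end

theorem mainTheorem4 (A : Type*) [CStarAlgebra A] :
    Set.BijOn (fun I : TwoSidedIdeal A => CStarNormal.idealV I)
      {I : TwoSidedIdeal A | CStarNormal.IsPerfectIdeal I}
      {H : Subgroup (A ≃⋆ₐ[ℂ] A) |
        H ≤ CStarNormal.autV A ∧ IsClosed (H : Set (A ≃⋆ₐ[ℂ] A)) ∧
          (H.subgroupOf (CStarNormal.autV A)).Normal ∧ CStarNormal.IsTopologicallyPerfect H} := by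
  refine ⟨fun I hI => ?_, fun I hI J hJ h => ?_, ?_⟩
  · refine ⟨CStarNormal.idealV_le_autV hI.isClosed, CStarNormal.isClosed_idealV I, ⟨?_⟩,
      CStarNormal.isTopologicallyPerfect_idealV hI.isClosed⟩
    exact fun ψ hψ φ => CStarNormal.conj_mem_idealV hI.isClosed φ.2 hψ
  · exact le_antisymm (CStarNormal.le_of_idealV_eq hI hJ.isClosed h)
      (CStarNormal.le_of_idealV_eq hJ hI.isClosed h.symm)
  · rintro H ⟨hHV, hH, hnormal, hperf⟩
    obtain ⟨J, hJ, rfl⟩ := CStarNormal.exists_idealV_eq hHV hH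
      (fun v hv ψ hψ => hnormal.conj_mem ⟨ψ, hHV hψ⟩ hψ ⟨v, hv⟩) hperf
    exact ⟨_, CStarNormal.isPerfectIdeal_closedIdeal_commutatorSpan J,
      CStarNormal.idealV_closedIdeal_commutatorSpan hJ⟩
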